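/- Let $k$ be an algebraically closed field of characteristic $0$, let $(X,\Lambda_0)$ be a nonsingular projective Poisson variety over $k$ (with bracket $\{-,-\}$ on $\mathcal{O}_X$), and let $(L,\nabla)$ be a Poisson invertible sheaf on it, i.e. an invertible sheaf with a flat Poisson connection, a $k$-bilinear bracket $\{a,s\}=\nabla(s)(a)$ of functions with sections of $L$. Choose an affine open covering $\{U_i\}$ of $X$ and frames $e_i$ of $L|_{U_i}$, and let $f_{ij}$ and $T_i$ be the transition functions and vector fields with $e_j=f_{ij}e_i$ and $\{a,e_i\}=T_i(a)e_i$; thus the coordinates of a section satisfy $s_i=f_{ij}s_j$. Brackets $[-,-]$ of polyvector fields are Schouten brackets. Let $L^\bullet$ be the complex $L\xrightarrow{\nabla}T_X\otimes L\xrightarrow{v_1}\wedge^2T_X\otimes L\to\cdots$, where $T_X\otimes L=Der(\mathcal{O}_X,L)$ and $v_1(\delta)(a,b)=\{a,\delta(b)\}-\{b,\delta(a)\}-\delta(\{a,b\})$. Let $\mathcal{E}_L^\bullet$ be the complex whose $p$-th term has as sections the systems $(a_i,b_i)$ of sections of $\wedge^pT_X\oplus\wedge^{p+1}T_X$ over the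 $U_i$ with $b_i=b_j$ and $a_j-a_i=f_{ij}^{-1}[b_i,f_{ij}]$, and with differential $(a_i,b_i)\mapsto([\Lambda_0,a_i]+(-1)^{p+1}[T_i,b_i],[\Lambda_0,b_i])$. Hypercohomology is computed by the Čech complexes of $\{U_i\}$; in particular $\mathbb{H}^0(X,\Lambda_0,L^\bullet,\nabla)$ is the group of global sections $s$ of $L$ with $\nabla s=0$. The rule $(a_i,b_i)\mapsto(s\mapsto (s_ia_i+[b_i,s_i])\,e_i)$ induces $$M_1:\mathbb{H}^1(X,\Lambda_0,\mathcal{E}_L^\bullet)\to \mathrm{Hom}\big(\mathbb{H}^0(X,\Lambda_0,L^\bullet,\nabla),\mathbb{H}^1(X,\Lambda_0,L^\bullet,\nabla)\big).$$ Let $(\mathcal{X},\Lambda,\mathcal{L},\nabla_{\mathcal{L}})$ be a first-order deformation of $(X,\Lambda_0,L,\nabla)$: a flat Poisson scheme $(\mathcal{X},\Lambda)$ over $\mathrm{Spec}\,k[\epsilon]$ and an invertible sheaf $\mathcal{L}$ on it with a $k[\epsilon]$-bilinear flat Poisson connection $\nabla_{\mathcal{L}}$, together with an identification of its restriction to the closed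 fibre with $(X,\Lambda_0,L,\nabla)$. Suppose that it is defined by the class $\eta\in\mathbb{H}^1(X,\Lambda_0,\mathcal{E}_L^\bullet)$. This means that there are trivialisations $\theta_i:\mathcal{O}_{\mathcal{X}}|_{U_i}\cong\mathcal{O}_{U_i}[\epsilon]$ of sheaves of $k[\epsilon]$-algebras, inducing the identity modulo $\epsilon$, and frames $E_i$ of $\mathcal{L}|_{U_i}$ lifting $e_i$, in which $\Lambda$ is $\Lambda_0+\epsilon\Lambda_i$, $\nabla_{\mathcal{L}}$ is given by $T_i+\epsilon W_i$, $\theta_i\theta_j^{-1}=\mathrm{Id}+\epsilon p_{ij}$ and $E_j=\theta_i^{-1}(f_{ij}+\epsilon f_{ij}a_{ij})E_i$, such that $\eta$ is the class of the cocycle $(\{(W_i,-\Lambda_i)\},\{(a_{ij},p_{ij})\})$, where $(W_i,-\Lambda_i)$ is read in the chart $i$ and $(a_{ij},p_{ij})$ in the chart $j$. Then a section $s\in\mathbb{H}^0(X,\Lambda_0,L^\bullet,\nabla)$ is the restriction to $X$ of a global section $\tilde s$ of $\mathcal{L}$ with $\nabla_{\mathcal{L}}\tilde s=0$, i.e. of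 an element of $\mathbb{H}^0(\mathcal{X},\Lambda,\mathcal{L}^\bullet,\nabla_{\mathcal{L}})$, if and only if $M_1(\eta)(s)=0$ in $\mathbb{H}^1(X,\Lambda_0,L^\bullet,\nabla)$. -/

import Mathlib

open CategoryTheory AlgebraicGeometry

universe u v

noncomputable section

namespace PoissonDeformation

/-! ### Sections, restriction, constants -/

/-- Functions on `V`. -/
abbrev Fn (X : Scheme.{u}) (V : X.Opens) : Type u := Γ(X, V)

/-- Sections of the `𝒪_X`-module `M` over `V`. -/
abbrev Sec {X : Scheme.{u}} (M : X.Modules) (V : X.Opens) : Type u := Γ(M, V)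

/-- Restriction of functions. -/
def rs {X : Scheme.{u}} {V W : X.Opens} (h : V ≤ W) : Fn X W →+* Fn X V :=
  (X.presheaf.map (homOfLE h).op).hom

/-- Restriction of sections of a module. -/
def rm {X : Scheme.{u}} (M : X.Modules) {V W : X.Opens} (h : V ≤ W) : Sec M W →+ Sec M V :=
  (M.presheaf.map (homOfLE h).op).hom

/-- The constants: the structure map `R → Γ(V, 𝒪_X)` of a scheme over `Spec R`. -/
def cst {R : Type u} [CommRing R] {X : Scheme.{u}} (f : X ⟶ Spec (.of R)) (V : X.Opens) :
    R →+* Fn X V :=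
  ((f.appLE ⊤ V le_top).hom).comp (Scheme.ΓSpecIso (.of R)).inv.hom

theorem rm_smul {X : Scheme.{u}} (M : X.Modules) {V W : X.Opens} (h : V ≤ W) (a : Fn X W)
    (s : Sec M W) : rm M h (a • s) = rs h a • rm M h s :=
  Scheme.Modules.map_smul M _ a s

theorem rm_rm {X : Scheme.{u}} (M : X.Modules) {V W Y : X.Opens} (h : V ≤ W) (h' : W ≤ Y)
    (s : Sec M Y) : rm M h (rm M h' s) = rm M (h.trans h') s := by
  simp only [rm, ← AddCommGrpCat.comp_apply, ← Functor.map_comp]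
  rfl

/-! ### Projective schemes -/

attribute [local instance] MvPolynomial.gradedAlgebra in
/-- `X` is projective over the field `k`: it admits a closed `k`-immersion into some `ℙⁿ_k`. -/
def IsProjectiveOver (k : Type u) [Field k] {X : Scheme.{u}} (f : X ⟶ Spec (.of k)) : Prop :=
  ∃ (n : ℕ) (j : X ⟶ Proj (MvPolynomial.homogeneousSubmodule (Fin (n + 1)) k)),
    IsClosedImmersion j ∧
      j ≫ Proj.toSpecZero (MvPolynomial.homogeneousSubmodule (Fin (n + 1)) k) ≫
        Spec.map (CommRingCat.ofHom
          (algebraMap k (MvPolynomial.homogeneousSubmodule (Fin (n + 1)) k 0))) = f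

/-! ### Poisson structures, flat Poisson connections, invertible sheaves -/

/-- A Poisson structure on the scheme `X` over `Spec R`: the structure sheaf is a sheaf of
Poisson `R`-algebras. -/
structure PoissonStructure {R : Type u} [CommRing R] {X : Scheme.{u}}
    (f : X ⟶ Spec (.of R)) where
  /-- the bracket `{a, b}` -/
  br : ∀ V : X.Opens, Fn X V → Fn X V → Fn X V
  add_left : ∀ V a b c, br V (a + b) c = br V a c + br V b c
  const_left : ∀ V (r : R) a b, br V (cst f V r * a) b = cst f V r * br V a b
  skew : ∀ V a b, br V a b = - br V b a
  leibniz : ∀ V a b c, br V (a * b) c = a * br V b c + b * br V a c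
  jacobi : ∀ V a b c, br V a (br V b c) + br V b (br V c a) + br V c (br V a b) = 0
  res : ∀ (V W : X.Opens) (h : V ≤ W) a b, rs h (br W a b) = br V (rs h a) (rs h b)

/-- A flat Poisson connection over `R` on an `𝒪_X`-module, i.e. the structure of a Poisson
`𝒪_X`-module. In terms of `∇ : M → Der(𝒪_X, M)`, `∇(s)(a) = {a, s}`. -/
structure FlatPoissonConnection {R : Type u} [CommRing R] {X : Scheme.{u}}
    {f : X ⟶ Spec (.of R)} (P : PoissonStructure f) (M : X.Modules) where
  /-- the bracket `{a, s}` -/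
  br : ∀ V : X.Opens, Fn X V → Sec M V → Sec M V
  add_left : ∀ V a b s, br V (a + b) s = br V a s + br V b s
  add_right : ∀ V a s t, br V a (s + t) = br V a s + br V a t
  const_left : ∀ V (r : R) a s, br V (cst f V r * a) s = cst f V r • br V a s
  const_right : ∀ V (r : R) a s, br V a (cst f V r • s) = cst f V r • br V a s
  leibniz_left : ∀ V a b s, br V (a * b) s = a • br V b s + b • br V a s
  leibniz_right : ∀ V a b s, br V a (b • s) = P.br V a b • s + b • br V a s
  flat : ∀ V a b s, br V a (br V b s) = br V (P.br V a b) s + br V b (br V a s)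
  res : ∀ (V W : X.Opens) (h : V ≤ W) a s, rm M h (br W a s) = br V (rs h a) (rm M h s)

/-- `e` is a frame of `M` over `U`: `a ↦ a • e` is an isomorphism `𝒪_U ≅ M|_U`. -/
def IsFrame {X : Scheme.{u}} (M : X.Modules) {U : X.Opens} (e : Sec M U) : Prop :=
  ∀ (V : X.Opens) (h : V ≤ U), Function.Bijective fun a : Fn X V => a • rm M h e

/-- Invertible sheaves: locally free of rank one. -/
def IsInvertibleSheaf {X : Scheme.{u}} (M : X.Modules) : Prop :=
  ∀ x : X, ∃ (U : X.Opens) (_ : x ∈ U) (e : Sec M U), IsFrame M e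

/-- `ℍ⁰(X, Λ, M^•, ∇)`: the global sections `s` of `M` with `∇ s = 0`. -/
def H0 {R : Type u} [CommRing R] {X : Scheme.{u}} {f : X ⟶ Spec (.of R)}
    {P : PoissonStructure f} {M : X.Modules} (D : FlatPoissonConnection P M) :
    AddSubgroup (Sec M ⊤) where
  carrier := {s | ∀ (V : X.Opens) (a : Fn X V), D.br V a (rm M le_top s) = 0}
  zero_mem' V a := by
    have h := D.add_right V a 0 0
    rw [add_zero] at h
    rw [map_zero]
    exact left_eq_add.mp h
  add_mem' {s t} hs ht V a := by
    rw [map_add, D.add_right, hs V a, ht V a, add_zero]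
  neg_mem' {s} hs V a := by
    have h0 := D.add_right V a 0 0
    rw [add_zero] at h0
    have h := D.add_right V a (rm M le_top s) (-(rm M le_top s))
    rw [add_neg_cancel, left_eq_add.mp h0, hs V a, zero_add] at h
    rw [map_neg]
    exact h.symm

/-! ### Schouten brackets in low degrees

A `p`-vector on an algebra is regarded as an alternating `p`-derivation. These are the values of
the Schouten bracket that occur in degrees `≤ 2` of the complexes below; `[P, a] = P(a, -)` for
a function `a` is written out directly. -/

/-- `[T, b]` for vector fields `T`, `b`. -/
def sch11 {A : Type u} [CommRing A] (T b : A → A) (x : A) : A := T (b x) - b (T x)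

/-- `[P, b]` for a bivector `P` and a vector field `b`. -/
def sch21 {A : Type u} [CommRing A] (P : A → A → A) (b : A → A) (x y : A) : A :=
  P (b x) y - P (b y) x - b (P x y)

/-- `[T, b]` for a vector field `T` and a bivector `b`. -/
def sch12 {A : Type u} [CommRing A] (T : A → A) (b : A → A → A) (x y : A) : A :=
  T (b x y) - (b (T x) y - b (T y) x)

/-- `[P, b]` for bivectors `P`, `b`. -/
def sch22 {A : Type u} [CommRing A] (P b : A → A → A) (x y z : A) : A :=
  (P (b x y) z - P (b x z) y + P (b y z) x) + (b (P x y) z - b (P x z) y + b (P y z) x)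

/-- `D` is an `R`-derivation of `Γ(V, 𝒪_X)` with values in the `Γ(V, 𝒪_X)`-module `N`. -/
structure IsDer {R : Type u} [CommRing R] {X : Scheme.{u}} (f : X ⟶ Spec (.of R))
    {V : X.Opens} {N : Type u} [AddCommGroup N] [Module (Fn X V) N] (D : Fn X V → N) : Prop where
  add : ∀ a b, D (a + b) = D a + D b
  const : ∀ (r : R) a, D (cst f V r * a) = cst f V r • D a
  leibniz : ∀ a b, D (a * b) = a • D b + b • D a

/-- `B` is a skew-symmetric `R`-biderivation of `Γ(V, 𝒪_X)`. -/
structure IsBiDer {R : Type u} [CommRing R] {X : Scheme.{u}} (f : X ⟶ Spec (.of R))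
    {V : X.Opens} (B : Fn X V → Fn X V → Fn X V) : Prop where
  der : ∀ b, IsDer f fun a => B a b
  skew : ∀ a b, B a b = - B b a

section closure

variable {R : Type u} [CommRing R] {X : Scheme.{u}} {f : X ⟶ Spec (.of R)} {V : X.Opens}

theorem IsDer.zero {N : Type u} [AddCommGroup N] [Module (Fn X V) N] :
    IsDer f (0 : Fn X V → N) :=
  ⟨by simp, by simp, by simp⟩

theorem IsDer.plus {N : Type u} [AddCommGroup N] [Module (Fn X V) N] {D E : Fn X V → N}
    (hD : IsDer f D) (hE : IsDer f E) : IsDer f (D + E) :=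
  ⟨fun a b => by simp only [Pi.add_apply, hD.add, hE.add]; abel,
    fun r a => by simp only [Pi.add_apply, hD.const, hE.const, smul_add],
    fun a b => by simp only [Pi.add_apply, hD.leibniz, hE.leibniz, smul_add]; abel⟩

theorem IsDer.neg {N : Type u} [AddCommGroup N] [Module (Fn X V) N] {D : Fn X V → N}
    (hD : IsDer f D) : IsDer f (-D) :=
  ⟨fun a b => by simp only [Pi.neg_apply, hD.add]; abel,
    fun r a => by simp only [Pi.neg_apply, hD.const, smul_neg],
    fun a b => by simp only [Pi.neg_apply, hD.leibniz, smul_neg]; abel⟩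

theorem IsBiDer.zero : IsBiDer f (0 : Fn X V → Fn X V → Fn X V) :=
  ⟨fun _ => IsDer.zero, by simp⟩

theorem IsBiDer.plus {B C : Fn X V → Fn X V → Fn X V} (hB : IsBiDer f B) (hC : IsBiDer f C) :
    IsBiDer f (B + C) :=
  ⟨fun b => (hB.der b).plus (hC.der b), fun a b => by
    simp only [Pi.add_apply]; rw [hB.skew a b, hC.skew a b]; abel⟩

theorem IsBiDer.neg {B : Fn X V → Fn X V → Fn X V} (hB : IsBiDer f B) : IsBiDer f (-B) :=
  ⟨fun b => (hB.der b).neg, fun a b => by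
    simp only [Pi.neg_apply]; rw [hB.skew a b]⟩

end closure

/-! ### Affine coverings that trivialise `L` -/

/-- An affine open covering `{U i}` of `X` with a frame `e i` of `L` over each `U i`. -/
structure FramedCover {X : Scheme.{u}} (L : X.Modules) (ι : Type v) where
  U : ι → X.Opens
  affine : ∀ i, IsAffineOpen (U i)
  cover : ⨆ i, U i = ⊤
  e : ∀ i, Sec L (U i)
  frame : ∀ i, IsFrame L (e i)

namespace FramedCover

variable {X : Scheme.{u}} {L : X.Modules} {ι : Type v} (C : FramedCover L ι)

/-- The restriction of the frame `e i` to `V ⊆ U i`. -/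
def eAt (i : ι) (V : X.Opens) (h : V ≤ C.U i) : Sec L V := rm L h (C.e i)

/-- The coordinate of a section of `L` over `V ⊆ U i` in the frame `e i`: `s = (coord s) • e i`. -/
def coord (i : ι) (V : X.Opens) (h : V ≤ C.U i) (s : Sec L V) : Fn X V :=
  (Equiv.ofBijective _ (C.frame i V h)).symm s

/-- The transition function `f_ij` on `V ⊆ U i ∩ U j`: the coordinates of a section `s` satisfy
`s_i = f_ij s_j`, i.e. `e_j = f_ij e_i`. -/
def trans (i j : ι) (V : X.Opens) (hi : V ≤ C.U i) (hj : V ≤ C.U j) : Fn X V :=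
  C.coord i V hi (C.eAt j V hj)

theorem coord_smul (i : ι) (V : X.Opens) (h : V ≤ C.U i) (s : Sec L V) :
    C.coord i V h s • C.eAt i V h = s :=
  (Equiv.ofBijective _ (C.frame i V h)).apply_symm_apply s

theorem smul_inj (i : ι) (V : X.Opens) (h : V ≤ C.U i) {a b : Fn X V}
    (hab : a • C.eAt i V h = b • C.eAt i V h) : a = b :=
  (C.frame i V h).1 hab

theorem coord_eq (i : ι) (V : X.Opens) (h : V ≤ C.U i) {s : Sec L V} {a : Fn X V}
    (ha : a • C.eAt i V h = s) : C.coord i V h s = a :=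
  C.smul_inj i V h ((C.coord_smul i V h s).trans ha.symm)

theorem rm_eAt (i : ι) {V W : X.Opens} (h : V ≤ W) (hW : W ≤ C.U i) :
    rm L h (C.eAt i W hW) = C.eAt i V (h.trans hW) :=
  rm_rm L h hW _

theorem rs_coord (i : ι) {V W : X.Opens} (h : V ≤ W) (hW : W ≤ C.U i) (s : Sec L W) :
    rs h (C.coord i W hW s) = C.coord i V (h.trans hW) (rm L h s) := by
  symm
  apply C.coord_eq
  rw [← C.rm_eAt i h hW, ← rm_smul, C.coord_smul]

theorem trans_smul (i j : ι) (V : X.Opens) (hi : V ≤ C.U i) (hj : V ≤ C.U j) :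
    C.trans i j V hi hj • C.eAt i V hi = C.eAt j V hj :=
  C.coord_smul i V hi _

/-- `f_ji` is the inverse of `f_ij`. -/
theorem trans_mul (i j : ι) (V : X.Opens) (hi : V ≤ C.U i) (hj : V ≤ C.U j) :
    C.trans j i V hj hi * C.trans i j V hi hj = 1 := by
  apply C.smul_inj i V hi
  rw [mul_smul, C.trans_smul, C.trans_smul, one_smul]

theorem coord_trans (i j : ι) (V : X.Opens) (hi : V ≤ C.U i) (hj : V ≤ C.U j) (s : Sec L V) :
    C.coord i V hi s = C.trans i j V hi hj * C.coord j V hj s := by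
  apply C.coord_eq
  rw [mul_comm, mul_smul, C.trans_smul, C.coord_smul]

theorem coord_add (i : ι) (V : X.Opens) (h : V ≤ C.U i) (s t : Sec L V) :
    C.coord i V h (s + t) = C.coord i V h s + C.coord i V h t :=
  C.coord_eq i V h (by rw [add_smul, C.coord_smul, C.coord_smul])

end FramedCover

section complexes

variable {R : Type u} [CommRing R] {X : Scheme.{u}} {f : X ⟶ Spec (.of R)}
  {P : PoissonStructure f} {L : X.Modules} (D : FlatPoissonConnection P L)
  {ι : Type v} (C : FramedCover L ι)

/-- The Poisson vector field `T_i` of the connection in the frame `e_i`: `{a, e_i} = T_i(a) e_i`. -/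
def vecT (i : ι) (V : X.Opens) (h : V ≤ C.U i) (a : Fn X V) : Fn X V :=
  C.coord i V h (D.br V a (C.eAt i V h))

/-! ### The complex `𝓔_L^•`

A section of `𝓔_L^p` over `U` is a system `(a_l, b_l)`, where `a_l` is a `p`-vector and `b_l` a
`(p+1)`-vector on `U ∩ U_l`, such that `b_i = b_j` and `a_j - a_i = [b_i, log f_ij]` on
`U ∩ U_i ∩ U_j`. A vector field on `U ∩ U_l` is given by its values on all opens `V ⊆ U ∩ U_l`. -/

/-- Systems of a function and a vector field (not yet subject to any condition). -/
abbrev Fam0 (U : X.Opens) : Type (max u v) :=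
  ∀ (l : ι) (V : {V : X.Opens // V ≤ U ∧ V ≤ C.U l}), Fn X V.1 × (Fn X V.1 → Fn X V.1)

/-- Systems of a vector field and a bivector (not yet subject to any condition). -/
abbrev Fam1 (U : X.Opens) : Type (max u v) :=
  ∀ (l : ι) (V : {V : X.Opens // V ≤ U ∧ V ≤ C.U l}),
    (Fn X V.1 → Fn X V.1) × (Fn X V.1 → Fn X V.1 → Fn X V.1)

variable (f)

/-- The sections of `𝓔_L^0` over `U`. -/
def E0 (U : X.Opens) : AddSubgroup (Fam0 C U) where
  carrier := {x |
    (∀ l V hU hl, IsDer f (x l ⟨V, hU, hl⟩).2) ∧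
    (∀ l V W (h : V ≤ W) hU hl,
      rs h (x l ⟨W, hU, hl⟩).1 = (x l ⟨V, h.trans hU, h.trans hl⟩).1 ∧
      ∀ a, rs h ((x l ⟨W, hU, hl⟩).2 a) = (x l ⟨V, h.trans hU, h.trans hl⟩).2 (rs h a)) ∧
    (∀ i j V hU hi hj,
      (x i ⟨V, hU, hi⟩).2 = (x j ⟨V, hU, hj⟩).2 ∧
      (x j ⟨V, hU, hj⟩).1 - (x i ⟨V, hU, hi⟩).1 =
        C.trans j i V hj hi * (x i ⟨V, hU, hi⟩).2 (C.trans i j V hi hj))}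
  zero_mem' := by
    refine ⟨fun _ _ _ _ => IsDer.zero, ?_, ?_⟩ <;> simp
  add_mem' := by
    rintro x y ⟨hx, hx', hx''⟩ ⟨hy, hy', hy''⟩
    refine ⟨fun l V hU hl => (hx l V hU hl).plus (hy l V hU hl), fun l V W h hU hl => ⟨?_, fun a => ?_⟩,
      fun i j V hU hi hj => ⟨?_, ?_⟩⟩
    · simp [(hx' l V W h hU hl).1, (hy' l V W h hU hl).1]
    · simp [(hx' l V W h hU hl).2, (hy' l V W h hU hl).2]
    · simp [(hx'' i j V hU hi hj).1, (hy'' i j V hU hi hj).1]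
    · have h1 := (hx'' i j V hU hi hj).2
      have h2 := (hy'' i j V hU hi hj).2
      simp only [Pi.add_apply, Prod.fst_add, Prod.snd_add]
      linear_combination h1 + h2
  neg_mem' := by
    rintro x ⟨hx, hx', hx''⟩
    refine ⟨fun l V hU hl => (hx l V hU hl).neg, fun l V W h hU hl => ⟨?_, fun a => ?_⟩,
      fun i j V hU hi hj => ⟨?_, ?_⟩⟩
    · simp [(hx' l V W h hU hl).1]
    · simp [(hx' l V W h hU hl).2]
    · simp [(hx'' i j V hU hi hj).1]
    · have h1 := (hx'' i j V hU hi hj).2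
      simp only [Pi.neg_apply, Prod.fst_neg, Prod.snd_neg]
      linear_combination -h1

/-- The sections of `𝓔_L^1` over `U`. -/
def E1 (U : X.Opens) : AddSubgroup (Fam1 C U) where
  carrier := {x |
    (∀ l V hU hl, IsDer f (x l ⟨V, hU, hl⟩).1 ∧ IsBiDer f (x l ⟨V, hU, hl⟩).2) ∧
    (∀ l V W (h : V ≤ W) hU hl,
      (∀ a, rs h ((x l ⟨W, hU, hl⟩).1 a) = (x l ⟨V, h.trans hU, h.trans hl⟩).1 (rs h a)) ∧
      ∀ a b, rs h ((x l ⟨W, hU, hl⟩).2 a b) =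
        (x l ⟨V, h.trans hU, h.trans hl⟩).2 (rs h a) (rs h b)) ∧
    (∀ i j V hU hi hj,
      (x i ⟨V, hU, hi⟩).2 = (x j ⟨V, hU, hj⟩).2 ∧
      ∀ a, (x j ⟨V, hU, hj⟩).1 a - (x i ⟨V, hU, hi⟩).1 a =
        C.trans j i V hj hi * (x i ⟨V, hU, hi⟩).2 (C.trans i j V hi hj) a)}
  zero_mem' := by
    refine ⟨fun _ _ _ _ => ⟨IsDer.zero, IsBiDer.zero⟩, ?_, ?_⟩ <;> simp
  add_mem' := by
    rintro x y ⟨hx, hx', hx''⟩ ⟨hy, hy', hy''⟩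
    refine ⟨fun l V hU hl => ⟨(hx l V hU hl).1.plus (hy l V hU hl).1,
        (hx l V hU hl).2.plus (hy l V hU hl).2⟩,
      fun l V W h hU hl => ⟨fun a => ?_, fun a b => ?_⟩,
      fun i j V hU hi hj => ⟨?_, fun a => ?_⟩⟩
    · simp [(hx' l V W h hU hl).1, (hy' l V W h hU hl).1]
    · simp [(hx' l V W h hU hl).2, (hy' l V W h hU hl).2]
    · simp [(hx'' i j V hU hi hj).1, (hy'' i j V hU hi hj).1]
    · have h1 := (hx'' i j V hU hi hj).2 a
      have h2 := (hy'' i j V hU hi hj).2 a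
      simp only [Pi.add_apply, Prod.fst_add, Prod.snd_add]
      linear_combination h1 + h2
  neg_mem' := by
    rintro x ⟨hx, hx', hx''⟩
    refine ⟨fun l V hU hl => ⟨(hx l V hU hl).1.neg, (hx l V hU hl).2.neg⟩,
      fun l V W h hU hl => ⟨fun a => ?_, fun a b => ?_⟩,
      fun i j V hU hi hj => ⟨?_, fun a => ?_⟩⟩
    · simp [(hx' l V W h hU hl).1]
    · simp [(hx' l V W h hU hl).2]
    · simp [(hx'' i j V hU hi hj).1]
    · have h1 := (hx'' i j V hU hi hj).2 a
      simp only [Pi.neg_apply, Prod.fst_neg, Prod.snd_neg]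
      linear_combination -h1

variable {f}

theorem vecT_smul (l : ι) (V : X.Opens) (hl : V ≤ C.U l) (a : Fn X V) :
    D.br V a (C.eAt l V hl) = vecT D C l V hl a • C.eAt l V hl :=
  (C.coord_smul l V hl _).symm

theorem vecT_add (l : ι) (V : X.Opens) (hl : V ≤ C.U l) (a b : Fn X V) :
    vecT D C l V hl (a + b) = vecT D C l V hl a + vecT D C l V hl b := by
  rw [vecT, D.add_left, C.coord_add]; rfl

/-- The differential `𝓔_L^0 → 𝓔_L^1` in the chart `l`:
`(a, b) ↦ ([Λ, a] - [T_l, b], [Λ, b])`. -/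
def dE0 (l : ι) (V : X.Opens) (hl : V ≤ C.U l) :
    (Fn X V × (Fn X V → Fn X V)) →+ (Fn X V → Fn X V) × (Fn X V → Fn X V → Fn X V) :=
  AddMonoidHom.mk'
    (fun x => (fun y => P.br V x.1 y - sch11 (vecT D C l V hl) x.2 y, sch21 (P.br V) x.2))
    (by
      intro x x'
      ext y z
      · simp only [sch11, Prod.fst_add, Prod.snd_add, Pi.add_apply, P.add_left, vecT_add]; ring
      · simp only [sch21, Prod.snd_add, Pi.add_apply, P.add_left]; ring)

/-- The differential `𝓔_L^1 → 𝓔_L^2` in the chart `l`: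
`(a, b) ↦ ([Λ, a] + [T_l, b], [Λ, b])`. -/
def dE1 (l : ι) (V : X.Opens) (hl : V ≤ C.U l) :
    (Fn X V → Fn X V) × (Fn X V → Fn X V → Fn X V) →+
      (Fn X V → Fn X V → Fn X V) × (Fn X V → Fn X V → Fn X V → Fn X V) :=
  AddMonoidHom.mk'
    (fun x => (fun y z => sch21 (P.br V) x.1 y z + sch12 (vecT D C l V hl) x.2 y z,
      sch22 (P.br V) x.2))
    (by
      intro x x'
      ext y z w
      · simp only [sch12, sch21, Prod.fst_add, Prod.snd_add, Pi.add_apply, P.add_left, vecT_add]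
        ring
      · simp only [sch22, Prod.snd_add, Pi.add_apply, P.add_left]; ring)

/-! ### The Čech hypercohomology group `ℍ¹(X, Λ, 𝓔_L^•)`

Total complex `C⁰(𝓔⁰) → C⁰(𝓔¹) ⊕ C¹(𝓔⁰) → C⁰(𝓔²) ⊕ C¹(𝓔¹) ⊕ C²(𝓔⁰)` of the covering, with
`z ↦ (d z, -δ z)` and `(x, y) ↦ (d x, δ x + d y, δ y)`. -/

variable (f) in
/-- `C⁰(𝓤, 𝓔_L^1) ⊕ C¹(𝓤, 𝓔_L^0)`. -/
abbrev CochE : Type (max u v) :=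
  (∀ i, E1 f C (C.U i)) × (∀ i j, E0 f C (C.U i ⊓ C.U j))

/-- The 1-cocycles. -/
def Z1E : AddSubgroup (CochE f C) where
  carrier := {c |
    (∀ i l V (h : V ≤ C.U i) (hl : V ≤ C.U l), dE1 D C l V hl ((c.1 i).1 l ⟨V, h, hl⟩) = 0) ∧
    (∀ i j l V (hi : V ≤ C.U i) (hj : V ≤ C.U j) (hl : V ≤ C.U l),
      ((c.1 j).1 l ⟨V, hj, hl⟩ - (c.1 i).1 l ⟨V, hi, hl⟩) +
        dE0 D C l V hl ((c.2 i j).1 l ⟨V, le_inf hi hj, hl⟩) = 0) ∧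
    (∀ i j k l V (hi : V ≤ C.U i) (hj : V ≤ C.U j) (hk : V ≤ C.U k) (hl : V ≤ C.U l),
      (c.2 j k).1 l ⟨V, le_inf hj hk, hl⟩ - (c.2 i k).1 l ⟨V, le_inf hi hk, hl⟩ +
        (c.2 i j).1 l ⟨V, le_inf hi hj, hl⟩ = 0)}
  zero_mem' := by
    refine ⟨fun i l V h hl => map_zero _, fun i j l V hi hj hl => ?_,
      fun i j k l V hi hj hk hl => ?_⟩
    · exact (congrArg₂ (· + ·) (sub_self _) (map_zero _)).trans (add_zero _)
    · exact (congrArg₂ (· + ·) (sub_self _) rfl).trans (add_zero _)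
  add_mem' := by
    rintro x y ⟨hx, hx', hx''⟩ ⟨hy, hy', hy''⟩
    refine ⟨fun i l V h hl => ?_, fun i j l V hi hj hl => ?_, fun i j k l V hi hj hk hl => ?_⟩
    · have h1 := hx i l V h hl
      have h2 := hy i l V h hl
      simp only [Prod.fst_add, Pi.add_apply, AddSubgroup.coe_add, map_add, h1, h2, add_zero]
    · have h1 := hx' i j l V hi hj hl
      have h2 := hy' i j l V hi hj hl
      simp only [Prod.fst_add, Prod.snd_add, Pi.add_apply, AddSubgroup.coe_add, map_add]
      rw [← add_zero (0 : (Fn X V → Fn X V) × (Fn X V → Fn X V → Fn X V))]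
      nth_rewrite 1 [← h1]
      rw [← h2]
      abel
    · have h1 := hx'' i j k l V hi hj hk hl
      have h2 := hy'' i j k l V hi hj hk hl
      simp only [Prod.snd_add, Pi.add_apply, AddSubgroup.coe_add]
      rw [← add_zero (0 : Fn X V × (Fn X V → Fn X V))]
      nth_rewrite 1 [← h1]
      rw [← h2]
      abel
  neg_mem' := by
    rintro x ⟨hx, hx', hx''⟩
    refine ⟨fun i l V h hl => ?_, fun i j l V hi hj hl => ?_, fun i j k l V hi hj hk hl => ?_⟩
    · have h1 := hx i l V h hl
      simp only [Prod.fst_neg, Pi.neg_apply, AddSubgroup.coe_neg, map_neg, h1, neg_zero]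
    · have h1 := hx' i j l V hi hj hl
      simp only [Prod.fst_neg, Prod.snd_neg, Pi.neg_apply, AddSubgroup.coe_neg, map_neg]
      rw [← neg_zero, ← h1]
      abel
    · have h1 := hx'' i j k l V hi hj hk hl
      simp only [Prod.snd_neg, Pi.neg_apply, AddSubgroup.coe_neg]
      rw [← neg_zero, ← h1]
      abel

/-- The 1-coboundaries. -/
def B1E : AddSubgroup (CochE f C) where
  carrier := {c | ∃ z : ∀ i, E0 f C (C.U i),
    (∀ i l V (h : V ≤ C.U i) (hl : V ≤ C.U l),
      (c.1 i).1 l ⟨V, h, hl⟩ = dE0 D C l V hl ((z i).1 l ⟨V, h, hl⟩)) ∧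
    (∀ i j l V (hi : V ≤ C.U i) (hj : V ≤ C.U j) (hl : V ≤ C.U l),
      (c.2 i j).1 l ⟨V, le_inf hi hj, hl⟩ =
        -((z j).1 l ⟨V, hj, hl⟩ - (z i).1 l ⟨V, hi, hl⟩))}
  zero_mem' :=
    ⟨0, fun i l V h hl => (map_zero _).symm, fun i j l V hi hj hl =>
      ((congrArg Neg.neg (sub_self _)).trans neg_zero).symm⟩
  add_mem' := by
    rintro x y ⟨z, hx, hx'⟩ ⟨w, hy, hy'⟩
    refine ⟨z + w, fun i l V h hl => ?_, fun i j l V hi hj hl => ?_⟩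
    · have h1 := hx i l V h hl
      have h2 := hy i l V h hl
      simp only [Prod.fst_add, Pi.add_apply, AddSubgroup.coe_add, map_add, h1, h2]
    · have h1 := hx' i j l V hi hj hl
      have h2 := hy' i j l V hi hj hl
      simp only [Prod.snd_add, Pi.add_apply, AddSubgroup.coe_add, h1, h2]
      abel
  neg_mem' := by
    rintro x ⟨z, hx, hx'⟩
    refine ⟨-z, fun i l V h hl => ?_, fun i j l V hi hj hl => ?_⟩
    · have h1 := hx i l V h hl
      simp only [Prod.fst_neg, Pi.neg_apply, AddSubgroup.coe_neg, map_neg, h1]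
    · have h1 := hx' i j l V hi hj hl
      simp only [Prod.snd_neg, Pi.neg_apply, AddSubgroup.coe_neg, h1]
      abel

/-- `ℍ¹(X, Λ, 𝓔_L^•)`. -/
abbrev H1E : Type (max u v) := Z1E D C ⧸ (B1E D C).addSubgroupOf (Z1E D C)

/-! ### The complex `L^•` and `ℍ¹(X, Λ, L^•, ∇)`

`L^0 = L`, `L^1 = Der(𝒪_X, L) = T_X ⊗ L` and `L^2 = Der²(𝒪_X, L) = ∧²T_X ⊗ L`, with
`v₀(s)(a) = {a, s}` and `v₁(δ)(a, b) = {a, δ b} - {b, δ a} - δ {a, b}`. The differentials of the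
total Čech complex are `z ↦ (v₀ z, δ z)` and `(x, y) ↦ (v₁ x, -δ x + v₀ y, -δ y)`. -/

variable (f L) in
/-- The sections of `L^1 = Der(𝒪_X, L)` over `U`. -/
def L1 (U : X.Opens) :
    AddSubgroup (∀ V : {V : X.Opens // V ≤ U}, Fn X V.1 → Sec L V.1) where
  carrier := {x | (∀ V, IsDer f (x V)) ∧
    ∀ V W (h : V ≤ W) (hW : W ≤ U) a,
      rm L h (x ⟨W, hW⟩ a) = x ⟨V, h.trans hW⟩ (rs h a)}
  zero_mem' := ⟨fun _ => IsDer.zero, by simp⟩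
  add_mem' := by
    rintro x y ⟨hx, hx'⟩ ⟨hy, hy'⟩
    exact ⟨fun V => (hx V).plus (hy V), fun V W h hW a => by simp [hx' V W h hW, hy' V W h hW]⟩
  neg_mem' := by
    rintro x ⟨hx, hx'⟩
    exact ⟨fun V => (hx V).neg, fun V W h hW a => by simp [hx' V W h hW]⟩

/-- `v₀ = ∇ : L → Der(𝒪_X, L)` on sections over `U`. -/
def v0 (U : X.Opens) : Sec L U →+ L1 f L U :=
  AddMonoidHom.mk'
    (fun s => ⟨fun V a => D.br V.1 a (rm L V.2 s),
      fun V => ⟨fun a b => D.add_left _ a b _, fun r a => D.const_left _ r a _,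
        fun a b => D.leibniz_left _ a b _⟩,
      fun V W h hW a => by rw [D.res _ _ h, rm_rm]⟩)
    (fun s t => by
      ext V a
      exact (congrArg _ (map_add _ s t)).trans (D.add_right _ a _ _))

/-- `v₁ : Der(𝒪_X, L) → Der²(𝒪_X, L)` on `V`. -/
def v1 (V : X.Opens) (x : Fn X V → Sec L V) (a b : Fn X V) : Sec L V :=
  D.br V a (x b) - D.br V b (x a) - x (P.br V a b)

variable (f) in
/-- `C⁰(𝓤, L^1) ⊕ C¹(𝓤, L^0)`. -/
abbrev CochL : Type (max u v) := (∀ i, L1 f L (C.U i)) × (∀ i j, Sec L (C.U i ⊓ C.U j))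

theorem br_zero (V : X.Opens) (a : Fn X V) : D.br V a 0 = 0 := by
  have h := D.add_right V a 0 0
  rw [add_zero] at h
  exact left_eq_add.mp h

theorem br_neg (V : X.Opens) (a : Fn X V) (s : Sec L V) : D.br V a (-s) = -D.br V a s := by
  have h := D.add_right V a s (-s)
  rw [add_neg_cancel, br_zero] at h
  exact (neg_eq_of_add_eq_zero_right h.symm).symm

/-- The 1-cocycles. -/
def Z1L : AddSubgroup (CochL f C) where
  carrier := {c |
    (∀ i V (h : V ≤ C.U i) a b, v1 D V ((c.1 i).1 ⟨V, h⟩) a b = 0) ∧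
    (∀ i j V (hi : V ≤ C.U i) (hj : V ≤ C.U j) a,
      -((c.1 j).1 ⟨V, hj⟩ a - (c.1 i).1 ⟨V, hi⟩ a) +
        (v0 D _ (c.2 i j)).1 ⟨V, le_inf hi hj⟩ a = 0) ∧
    (∀ i j k V (hi : V ≤ C.U i) (hj : V ≤ C.U j) (hk : V ≤ C.U k),
      -(rm L (le_inf hj hk) (c.2 j k) - rm L (le_inf hi hk) (c.2 i k) +
        rm L (le_inf hi hj) (c.2 i j)) = 0)}
  zero_mem' := by
    refine ⟨fun i V h a b => ?_, fun i j V hi hj a => ?_, fun i j k V hi hj hk => ?_⟩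
    · simp [v1, br_zero]
    · simp
    · simp
  add_mem' := by
    rintro x y ⟨hx, hx', hx''⟩ ⟨hy, hy', hy''⟩
    refine ⟨fun i V h a b => ?_, fun i j V hi hj a => ?_, fun i j k V hi hj hk => ?_⟩
    · have h1 := hx i V h a b
      have h2 := hy i V h a b
      simp only [v1, Prod.fst_add, Pi.add_apply, AddSubgroup.coe_add, D.add_right] at h1 h2 ⊢
      rw [← add_zero (0 : Sec L V)]
      nth_rewrite 1 [← h1]
      rw [← h2]
      abel
    · have h1 := hx' i j V hi hj a
      have h2 := hy' i j V hi hj a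
      simp only [Prod.fst_add, Prod.snd_add, Pi.add_apply, AddSubgroup.coe_add, map_add]
      rw [← add_zero (0 : Sec L V)]
      nth_rewrite 1 [← h1]
      rw [← h2]
      abel
    · have h1 := hx'' i j k V hi hj hk
      have h2 := hy'' i j k V hi hj hk
      simp only [Prod.snd_add, Pi.add_apply, map_add]
      rw [← add_zero (0 : Sec L V)]
      nth_rewrite 1 [← h1]
      rw [← h2]
      abel
  neg_mem' := by
    rintro x ⟨hx, hx', hx''⟩
    refine ⟨fun i V h a b => ?_, fun i j V hi hj a => ?_, fun i j k V hi hj hk => ?_⟩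
    · have h1 := hx i V h a b
      simp only [v1, Prod.fst_neg, Pi.neg_apply, AddSubgroup.coe_neg, br_neg] at h1 ⊢
      rw [← neg_zero, ← h1]
      abel
    · have h1 := hx' i j V hi hj a
      simp only [Prod.fst_neg, Prod.snd_neg, Pi.neg_apply, AddSubgroup.coe_neg, map_neg]
      rw [← neg_zero, ← h1]
      abel
    · have h1 := hx'' i j k V hi hj hk
      simp only [Prod.snd_neg, Pi.neg_apply, map_neg]
      rw [← neg_zero, ← h1]
      abel

/-- The 1-coboundaries. -/
def B1L : AddSubgroup (CochL f C) where
  carrier := {c | ∃ z : ∀ i, Sec L (C.U i), (∀ i, c.1 i = v0 D _ (z i)) ∧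
    ∀ i j, c.2 i j = rm L inf_le_right (z j) - rm L inf_le_left (z i)}
  zero_mem' := ⟨0, fun i => (map_zero _).symm, fun i j => by simp⟩
  add_mem' := by
    rintro x y ⟨z, hx, hx'⟩ ⟨w, hy, hy'⟩
    refine ⟨z + w, fun i => ?_, fun i j => ?_⟩
    · simp only [Prod.fst_add, Pi.add_apply, map_add, hx, hy]
    · simp only [Prod.snd_add, Pi.add_apply, map_add, hx', hy']
      abel
  neg_mem' := by
    rintro x ⟨z, hx, hx'⟩
    refine ⟨-z, fun i => ?_, fun i j => ?_⟩
    · simp only [Prod.fst_neg, Pi.neg_apply, map_neg, hx]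
    · simp only [Prod.snd_neg, Pi.neg_apply, map_neg, hx']
      abel

/-- `ℍ¹(X, Λ, L^•, ∇)`. -/
abbrev H1L : Type (max u v) := Z1L D C ⧸ (B1L D C).addSubgroupOf (Z1L D C)

/-! ### The homomorphism `M_1` -/

/-- `M_0(a, b)(s)` on `V ⊆ U_l`: the section of `L` with coordinate `s_l a + [b, s_l]` in the
frame `e_l`. -/
def M0At (l : ι) (V : X.Opens) (hl : V ≤ C.U l) (x : Fn X V × (Fn X V → Fn X V)) (s : Sec L V) :
    Sec L V :=
  (C.coord l V hl s * x.1 + x.2 (C.coord l V hl s)) • C.eAt l V hl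

/-- `M_1(a, b)(s)` on `V ⊆ U_l`: the section of `T_X ⊗ L` with coordinate `s_l a + [b, s_l]` in
the frame `e_l`. -/
def M1At (l : ι) (V : X.Opens) (hl : V ≤ C.U l)
    (x : (Fn X V → Fn X V) × (Fn X V → Fn X V → Fn X V)) (s : Sec L V) (y : Fn X V) : Sec L V :=
  (C.coord l V hl s * x.1 y + x.2 (C.coord l V hl s) y) • C.eAt l V hl

/-- `M_0` does not depend on the chart. -/
theorem M0At_chart {U : X.Opens} (x : E0 f C U) (i j : ι) (V : X.Opens) (hU : V ≤ U)
    (hi : V ≤ C.U i) (hj : V ≤ C.U j) (s : Sec L V) :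
    M0At C i V hi (x.1 i ⟨V, hU, hi⟩) s = M0At C j V hj (x.1 j ⟨V, hU, hj⟩) s := by
  obtain ⟨h1, h2⟩ := x.2.2.2 i j V hU hi hj
  have hd := (x.2.1 i V hU hi).leibniz
  have h3 := C.trans_mul i j V hi hj
  rw [M0At, M0At, ← C.trans_smul i j V hi hj, smul_smul, C.coord_trans i j V hi hj s, ← h1, hd]
  congr 1
  simp only [smul_eq_mul]
  generalize C.trans i j V hi hj = t at *
  linear_combination (-C.coord j V hj s * t) * h2 - C.coord j V hj s * (x.1 i ⟨V, hU, hi⟩).2 t * h3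

/-- `M_1` does not depend on the chart. -/
theorem M1At_chart {U : X.Opens} (x : E1 f C U) (i j : ι) (V : X.Opens) (hU : V ≤ U)
    (hi : V ≤ C.U i) (hj : V ≤ C.U j) (s : Sec L V) (y : Fn X V) :
    M1At C i V hi (x.1 i ⟨V, hU, hi⟩) s y = M1At C j V hj (x.1 j ⟨V, hU, hj⟩) s y := by
  obtain ⟨h1, h2⟩ := x.2.2.2 i j V hU hi hj
  have hd := ((x.2.1 i V hU hi).2.der y).leibniz
  have h3 := C.trans_mul i j V hi hj
  replace h2 := h2 y
  rw [M1At, M1At, ← C.trans_smul i j V hi hj, smul_smul, C.coord_trans i j V hi hj s, ← h1, hd]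
  congr 1
  simp only [smul_eq_mul]
  generalize C.trans i j V hi hj = t at *
  linear_combination
    (-C.coord j V hj s * t) * h2 - C.coord j V hj s * (x.1 i ⟨V, hU, hi⟩).2 t y * h3

theorem M0At_res {U : X.Opens} (x : E0 f C U) (l : ι) {V W : X.Opens} (h : V ≤ W) (hU : W ≤ U)
    (hl : W ≤ C.U l) (s : Sec L W) :
    rm L h (M0At C l W hl (x.1 l ⟨W, hU, hl⟩) s) =
      M0At C l V (h.trans hl) (x.1 l ⟨V, h.trans hU, h.trans hl⟩) (rm L h s) := by
  obtain ⟨h1, h2⟩ := x.2.2.1 l V W h hU hl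
  rw [M0At, M0At, rm_smul, C.rm_eAt, map_add, map_mul, h1, h2, C.rs_coord]

theorem M1At_res {U : X.Opens} (x : E1 f C U) (l : ι) {V W : X.Opens} (h : V ≤ W) (hU : W ≤ U)
    (hl : W ≤ C.U l) (s : Sec L W) (y : Fn X W) :
    rm L h (M1At C l W hl (x.1 l ⟨W, hU, hl⟩) s y) =
      M1At C l V (h.trans hl) (x.1 l ⟨V, h.trans hU, h.trans hl⟩) (rm L h s) (rs h y) := by
  obtain ⟨h1, h2⟩ := x.2.2.1 l V W h hU hl
  rw [M1At, M1At, rm_smul, C.rm_eAt, map_add, map_mul, h1, h2, C.rs_coord]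

theorem M0At_add_left (l : ι) (V : X.Opens) (hl : V ≤ C.U l) (x y) (s : Sec L V) :
    M0At C l V hl (x + y) s = M0At C l V hl x s + M0At C l V hl y s := by
  simp only [M0At, Prod.fst_add, Prod.snd_add, Pi.add_apply, ← add_smul]
  congr 1
  ring

theorem M1At_add_left (l : ι) (V : X.Opens) (hl : V ≤ C.U l) (x y) (s : Sec L V) (z : Fn X V) :
    M1At C l V hl (x + y) s z = M1At C l V hl x s z + M1At C l V hl y s z := by
  simp only [M1At, Prod.fst_add, Prod.snd_add, Pi.add_apply, ← add_smul]
  congr 1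
  ring

theorem M0At_add_right {l : ι} {V : X.Opens} {hl : V ≤ C.U l} {x : Fn X V × (Fn X V → Fn X V)}
    (hx : IsDer f x.2) (s t : Sec L V) :
    M0At C l V hl x (s + t) = M0At C l V hl x s + M0At C l V hl x t := by
  simp only [M0At, C.coord_add, hx.add, ← add_smul]
  congr 1
  ring

theorem M1At_add_right {l : ι} {V : X.Opens} {hl : V ≤ C.U l}
    {x : (Fn X V → Fn X V) × (Fn X V → Fn X V → Fn X V)}
    (hx : IsBiDer f x.2) (s t : Sec L V) (y : Fn X V) :
    M1At C l V hl x (s + t) y = M1At C l V hl x s y + M1At C l V hl x t y := by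
  simp only [M1At, C.coord_add, (hx.der y).add, ← add_smul]
  congr 1
  ring

theorem M1At_isDer {l : ι} {V : X.Opens} {hl : V ≤ C.U l}
    {x : (Fn X V → Fn X V) × (Fn X V → Fn X V → Fn X V)}
    (hx : IsDer f x.1) (hx' : IsBiDer f x.2) (s : Sec L V) :
    IsDer f (M1At C l V hl x s) where
  add a b := by
    simp only [M1At, hx.add, hx'.skew _ (a + b), (hx'.der _).add, hx'.skew _ a, hx'.skew _ b,
      ← add_smul]
    congr 1
    ring
  const r a := by
    simp only [M1At, hx.const, hx'.skew _ (cst f V r * a), (hx'.der _).const, hx'.skew _ a,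
      smul_smul, smul_eq_mul]
    congr 1
    ring
  leibniz a b := by
    simp only [M1At, hx.leibniz, hx'.skew _ (a * b), (hx'.der _).leibniz, hx'.skew _ a,
      hx'.skew _ b, smul_smul, smul_eq_mul, ← add_smul]
    congr 1
    ring

theorem PoissonStructure.add_right (V : X.Opens) (a b c : Fn X V) :
    P.br V a (b + c) = P.br V a b + P.br V a c := by
  rw [P.skew V a, P.add_left, P.skew V b, P.skew V c]; ring

theorem PoissonStructure.leibniz_right (V : X.Opens) (a b c : Fn X V) :
    P.br V a (b * c) = b * P.br V a c + c * P.br V a b := by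
  rw [P.skew V a, P.leibniz, P.skew V b, P.skew V c]; ring

theorem br_coord (l : ι) (V : X.Opens) (hl : V ≤ C.U l) (a u : Fn X V) :
    D.br V a (u • C.eAt l V hl) = (P.br V a u + u * vecT D C l V hl a) • C.eAt l V hl := by
  rw [D.leibniz_right, vecT_smul, smul_smul, add_smul]

theorem flat_coord (l : ι) (V : X.Opens) (hl : V ≤ C.U l) {s : Sec L V}
    (hs : ∀ a, D.br V a s = 0) (a : Fn X V) :
    P.br V a (C.coord l V hl s) = -(C.coord l V hl s * vecT D C l V hl a) := by
  have h := hs a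
  rw [← C.coord_smul l V hl s, br_coord] at h
  have h2 := C.smul_inj l V hl (h.trans (zero_smul _ _).symm)
  linear_combination h2

/-- `v₀ M_0 = - M_1 d` on a horizontal section. -/
theorem br_M0At (l : ι) (V : X.Opens) (hl : V ≤ C.U l) {s : Sec L V}
    (hs : ∀ a, D.br V a s = 0) {x : Fn X V × (Fn X V → Fn X V)} (hx : IsDer f x.2)
    (y : Fn X V) :
    D.br V y (M0At C l V hl x s) = -M1At C l V hl (dE0 D C l V hl x) s y := by
  have hf := flat_coord D C l V hl hs
  rw [M0At, br_coord, M1At, ← neg_smul]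
  congr 1
  generalize C.coord l V hl s = σ at *
  generalize hT : vecT D C l V hl = T at *
  have e1 := hf y
  have e2 := hf (x.2 y)
  have e3 : x.2 (P.br V y σ) = -(σ * x.2 (T y) + T y * x.2 σ) := by
    rw [e1]
    have h := hx.add (σ * T y) (-(σ * T y))
    have h0 := hx.add 0 0
    rw [add_zero] at h0
    rw [add_neg_cancel, left_eq_add.mp h0, hx.leibniz] at h
    simp only [smul_eq_mul] at h
    linear_combination -h
  have e4 : x.2 (P.br V σ y) = σ * x.2 (T y) + T y * x.2 σ := by
    rw [P.skew V σ y, e1, neg_neg, hx.leibniz]; simp only [smul_eq_mul]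
  simp only [dE0, AddMonoidHom.mk'_apply, hT, sch11, sch21, P.add_right, P.leibniz_right]
  rw [e1, e2, e4, P.skew V x.1 y, P.skew V (x.2 σ) y]
  ring

/-- `v₁ M_1 = M_2 d` on a horizontal section. -/
theorem v1_M1At (l : ι) (V : X.Opens) (hl : V ≤ C.U l) {s : Sec L V}
    (hs : ∀ a, D.br V a s = 0) {x : (Fn X V → Fn X V) × (Fn X V → Fn X V → Fn X V)}
    (hx' : IsBiDer f x.2) (y z : Fn X V) :
    v1 D V (M1At C l V hl x s) y z =
      (C.coord l V hl s * (dE1 D C l V hl x).1 y z +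
        (dE1 D C l V hl x).2 (C.coord l V hl s) y z) • C.eAt l V hl := by
  have hf := flat_coord D C l V hl hs
  simp only [v1, M1At, br_coord, ← sub_smul]
  congr 1
  generalize C.coord l V hl s = σ at *
  generalize hT : vecT D C l V hl = T at *
  have e4 : ∀ w w', x.2 (P.br V σ w) w' = σ * x.2 (T w) w' + T w * x.2 σ w' := by
    intro w w'
    rw [P.skew V σ w, hf w, neg_neg, (hx'.der w').leibniz]; simp only [smul_eq_mul]
  simp only [dE1, AddMonoidHom.mk'_apply, hT, sch12, sch21, sch22, P.add_right, P.leibniz_right]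
  rw [e4, e4, hf y, hf z, hf (x.2 y z), P.skew V (x.2 σ y) z, P.skew V (x.2 σ z) y,
    hx'.skew (P.br V y z) σ, P.skew V (x.1 y) z, P.skew V (x.1 z) y]
  ring

theorem H0_flat (s : H0 D) (V : X.Opens) (a : Fn X V) : D.br V a (rm L le_top s.1) = 0 :=
  s.2 V a

/-- `M` on Čech 1-cochains: `(x, y)` and `s` are sent to
`({M_1(x_i)(s)}, {M_0(y_ij)(s)})`, where `x_i` is read in the chart `i` and `y_ij` in the
chart `j`. -/
def MCoch (c : CochE f C) (s : Sec L ⊤) : CochL f C :=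
  (fun i => ⟨fun V => M1At C i V.1 V.2 ((c.1 i).1 i ⟨V.1, V.2, V.2⟩) (rm L le_top s),
    fun V => M1At_isDer C ((c.1 i).2.1 i V.1 V.2 V.2).1 ((c.1 i).2.1 i V.1 V.2 V.2).2 _,
    fun V W h hW a => by rw [M1At_res C (c.1 i) i h hW hW, rm_rm]⟩,
  fun i j => M0At C j (C.U i ⊓ C.U j) inf_le_right ((c.2 i j).1 j ⟨_, le_rfl, inf_le_right⟩)
    (rm L le_top s))

theorem MCoch_snd (c : CochE f C) (s : Sec L ⊤) (i j l : ι) (V : X.Opens) (hi : V ≤ C.U i)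
    (hj : V ≤ C.U j) (hl : V ≤ C.U l) :
    rm L (le_inf hi hj) ((MCoch C c s).2 i j) =
      M0At C l V hl ((c.2 i j).1 l ⟨V, le_inf hi hj, hl⟩) (rm L le_top s) := by
  rw [MCoch, M0At_res C (c.2 i j) j (le_inf hi hj) le_rfl inf_le_right, rm_rm,
    M0At_chart C (c.2 i j) l j V (le_inf hi hj) hl hj]

theorem MCoch_fst (c : CochE f C) (s : Sec L ⊤) (i l : ι) (V : X.Opens) (hi : V ≤ C.U i)
    (hl : V ≤ C.U l) (a : Fn X V) :
    ((MCoch C c s).1 i).1 ⟨V, hi⟩ a =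
      M1At C l V hl ((c.1 i).1 l ⟨V, hi, hl⟩) (rm L le_top s) a :=
  M1At_chart C (c.1 i) i l V hi hi hl _ a

theorem MCoch_add_left (c c' : CochE f C) (s : Sec L ⊤) :
    MCoch C (c + c') s = MCoch C c s + MCoch C c' s := by
  apply Prod.ext
  · funext i
    apply Subtype.ext
    funext V a
    exact M1At_add_left C i V.1 V.2 _ _ _ a
  · funext i j
    exact M0At_add_left C j _ _ _ _ _

theorem MCoch_add_right (c : CochE f C) (s t : Sec L ⊤) :
    MCoch C c (s + t) = MCoch C c s + MCoch C c t := by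
  apply Prod.ext
  · funext i
    apply Subtype.ext
    funext V a
    refine (congrArg (fun w => M1At C i V.1 V.2 _ w a) (map_add _ s t)).trans ?_
    exact M1At_add_right C ((c.1 i).2.1 i V.1 V.2 V.2).2 _ _ a
  · funext i j
    refine (congrArg (fun w => M0At C j _ _ _ w) (map_add _ s t)).trans ?_
    exact M0At_add_right C ((c.2 i j).2.1 j _ le_rfl inf_le_right) _ _

theorem MCoch_mem (c : Z1E D C) (s : H0 D) : MCoch C c.1 s.1 ∈ Z1L D C := by
  obtain ⟨h1, h2, h3⟩ := c.2
  refine ⟨fun i V h a b => ?_, fun i j V hi hj a => ?_, fun i j k V hi hj hk => ?_⟩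
  · have := v1_M1At D C i V h (H0_flat D s V) ((c.1.1 i).2.1 i V h h).2 a b
    rw [h1 i i V h h] at this
    refine this.trans ?_
    simp
  · have e := h2 i j j V hi hj hj
    have hv : ((v0 D _ ((MCoch C c.1 s.1).2 i j) : L1 f L _).1 ⟨V, le_inf hi hj⟩ a) =
        D.br V a (rm L (le_inf hi hj) ((MCoch C c.1 s.1).2 i j)) := rfl
    rw [hv, MCoch_snd C c.1 s.1 i j j V hi hj hj, MCoch_fst C c.1 s.1 j j V hj hj,
      MCoch_fst C c.1 s.1 i j V hi hj,
      br_M0At D C j V hj (H0_flat D s V) ((c.1.2 i j).2.1 j V (le_inf hi hj) hj)]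
    have e' : (c.1.1 j).1 j ⟨V, hj, hj⟩ =
        (c.1.1 i).1 j ⟨V, hi, hj⟩ +
          -(dE0 D C j V hj ((c.1.2 i j).1 j ⟨V, le_inf hi hj, hj⟩)) := by
      rw [← sub_eq_iff_eq_add', eq_neg_iff_add_eq_zero]; exact e
    have e'' := congrArg (fun w => M1At C j V hj w (rm L le_top s.1) a)
      (sub_eq_iff_eq_add'.mp (eq_neg_of_add_eq_zero_left e))
    have z := M1At_add_left C j V hj (dE0 D C j V hj ((c.1.2 i j).1 j ⟨V, le_inf hi hj, hj⟩))
      (-(dE0 D C j V hj ((c.1.2 i j).1 j ⟨V, le_inf hi hj, hj⟩))) (rm L le_top s.1) a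
    rw [add_neg_cancel] at z
    have z0 : M1At C j V hj 0 (rm L le_top s.1) a = 0 := by simp [M1At]
    rw [z0] at z
    simp only [M1At_add_left] at e''
    rw [e'', eq_neg_of_add_eq_zero_right z.symm]
    abel
  · have e := h3 i j k k V hi hj hk hk
    rw [MCoch_snd C c.1 s.1 j k k V hj hk hk, MCoch_snd C c.1 s.1 i k k V hi hk hk,
      MCoch_snd C c.1 s.1 i j k V hi hj hk]
    have e' : (c.1.2 j k).1 k ⟨V, le_inf hj hk, hk⟩ + (c.1.2 i j).1 k ⟨V, le_inf hi hj, hk⟩ =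
        (c.1.2 i k).1 k ⟨V, le_inf hi hk, hk⟩ := by
      rw [← sub_eq_zero, ← e]; abel
    rw [← e', M0At_add_left]
    abel

theorem MCoch_bdry {c : CochE f C} (hc : c ∈ B1E D C) (s : H0 D) :
    MCoch C c s.1 ∈ B1L D C := by
  obtain ⟨z, h1, h2⟩ := hc
  refine ⟨fun i => -M0At C i (C.U i) le_rfl ((z i).1 i ⟨_, le_rfl, le_rfl⟩) (rm L le_top s.1),
    fun i => ?_, fun i j => ?_⟩
  · apply Subtype.ext
    funext V a
    have hv : (v0 D (C.U i) (-M0At C i (C.U i) le_rfl ((z i).1 i ⟨_, le_rfl, le_rfl⟩)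
        (rm L le_top s.1)) : L1 f L _).1 V a =
        D.br V.1 a (rm L V.2 (-M0At C i (C.U i) le_rfl ((z i).1 i ⟨_, le_rfl, le_rfl⟩)
        (rm L le_top s.1))) := rfl
    rw [hv, map_neg, M0At_res C (z i) i V.2 le_rfl le_rfl, rm_rm, br_neg,
      br_M0At D C i V.1 V.2 (H0_flat D s V.1) ((z i).2.1 i V.1 V.2 V.2), neg_neg,
      ← h1 i i V.1 V.2 V.2]
    rfl
  · have e := h2 i j j (C.U i ⊓ C.U j) inf_le_left inf_le_right inf_le_right
    rw [map_neg, map_neg, M0At_res C (z j) j inf_le_right le_rfl le_rfl,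
      M0At_res C (z i) i inf_le_left le_rfl le_rfl, rm_rm, rm_rm,
      M0At_chart C (z i) i j _ inf_le_left inf_le_left inf_le_right]
    have e' : (c.2 i j).1 j ⟨C.U i ⊓ C.U j, le_rfl, inf_le_right⟩ +
        (z j).1 j ⟨C.U i ⊓ C.U j, inf_le_right, inf_le_right⟩ =
        (z i).1 j ⟨C.U i ⊓ C.U j, inf_le_left, inf_le_right⟩ := by
      rw [e]; abel
    rw [← e', M0At_add_left]
    simp only [MCoch]
    abel

/-- The homomorphism `M_1 : ℍ¹(X, Λ, 𝓔_L^•) → Hom(ℍ⁰(X, Λ, L^•, ∇), ℍ¹(X, Λ, L^•, ∇))`. -/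
def M1 : H1E D C →+ H0 D →+ H1L D C :=
  QuotientAddGroup.lift _
    (AddMonoidHom.mk'
      (fun c : Z1E D C => AddMonoidHom.mk'
        (fun s : H0 D => (QuotientAddGroup.mk ⟨MCoch C c.1 s.1, MCoch_mem D C c s⟩ : H1L D C))
        (fun s t => congrArg QuotientAddGroup.mk (Subtype.ext (MCoch_add_right C c.1 s.1 t.1))))
      (fun c c' => by
        ext s
        exact congrArg QuotientAddGroup.mk (Subtype.ext (MCoch_add_left C c.1 c'.1 s.1))))
    (fun c hc => by
      ext s
      exact (QuotientAddGroup.eq_zero_iff _).mpr (MCoch_bdry D C hc s))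

end complexes

/-! ### First-order simultaneous deformations -/

/-- The closed point `Spec k → Spec k[ε]`. -/
def closedPoint (k : Type u) [Field k] : Spec (.of k) ⟶ Spec (.of (DualNumber k)) :=
  Spec.map (CommRingCat.ofHom (TrivSqZeroExt.fstHom k k k).toRingHom)

/-- A first-order deformation `(𝒳, Λ, ℒ, ∇_ℒ)` of `(X, Λ₀, L, ∇)` over `Spec k[ε]`. -/
structure FirstOrderDeformation {k : Type u} [Field k] {X : Scheme.{u}} {f : X ⟶ Spec (.of k)}
    (P : PoissonStructure f) {L : X.Modules} (D : FlatPoissonConnection P L) where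
  /-- the total space `𝒳` -/
  tot : Scheme.{u}
  /-- the structure morphism `𝒳 → Spec k[ε]` -/
  str : tot ⟶ Spec (.of (DualNumber k))
  flat : Flat str
  /-- the inclusion `X → 𝒳` of the closed fibre -/
  incl : X ⟶ tot
  isPullback : IsPullback incl f str (closedPoint k)
  /-- the Poisson structure on `𝒳` over `k[ε]` -/
  poisson : PoissonStructure str
  incl_poisson : ∀ (W : tot.Opens) (a b : Fn tot W),
    incl.app W (poisson.br W a b) = P.br (incl ⁻¹ᵁ W) (incl.app W a) (incl.app W b)
  /-- the invertible sheaf `ℒ` -/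
  sheaf : tot.Modules
  invertible : IsInvertibleSheaf sheaf
  /-- the flat Poisson connection on `ℒ` over `k[ε]` -/
  conn : FlatPoissonConnection poisson sheaf
  /-- the restriction `ℒ → incl_* L` of sections to `X` -/
  restr : sheaf ⟶ (Scheme.Modules.pushforward incl).obj L
  /-- the morphism `incl^* ℒ → L` adjoint to the restriction is an isomorphism -/
  restr_iso : IsIso
    (((Scheme.Modules.pullbackPushforwardAdjunction incl).homEquiv sheaf L).symm restr)
  restr_conn : ∀ (W : tot.Opens) (a : Fn tot W) (s : Sec sheaf W),
    (restr.app W (conn.br W a s) : Sec L (incl ⁻¹ᵁ W)) =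
      D.br (incl ⁻¹ᵁ W) (incl.app W a) (restr.app W s)

namespace FirstOrderDeformation

variable {k : Type u} [Field k] {X : Scheme.{u}} {f : X ⟶ Spec (.of k)}
  {P : PoissonStructure f} {L : X.Modules} {D : FlatPoissonConnection P L}
  (T : FirstOrderDeformation P D) {ι : Type v} (C : FramedCover L ι)

/-- `s ∈ ℍ⁰(X, Λ₀, L^•, ∇)` extends to `ℍ⁰(𝒳, Λ, ℒ^•, ∇_ℒ)`. -/
def Extends (s : H0 D) : Prop :=
  ∃ t : H0 T.conn, (T.restr.app ⊤ t.1 : Sec L ⊤) = s.1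

/-- A trivialisation of `(𝒳, ℒ)` over `U i`: an isomorphism `𝒳|_{U i} ≅ U i × Spec k[ε]` over
`k[ε]` extending the identity of `U i`, given by the isomorphism `θ` of sheaves of
`k[ε]`-algebras, and a frame of `ℒ` which lifts the frame `e i` of `L`. Here `W` runs through the
opens of `𝒳` (which has the same underlying space as `X`) whose trace on `X` lies in `U i`. -/
structure LocalTriv (i : ι) where
  θ : ∀ W : T.tot.Opens, T.incl ⁻¹ᵁ W ≤ C.U i →
    Fn T.tot W ≃+* DualNumber (Fn X (T.incl ⁻¹ᵁ W))
  θ_const : ∀ W h (r : DualNumber k),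
    θ W h (cst T.str W r) = (cst f _ r.fst, cst f _ r.snd)
  θ_fst : ∀ W h (a : Fn T.tot W), (θ W h a).fst = T.incl.app W a
  θ_res : ∀ (V W : T.tot.Opens) (hVW : V ≤ W) (hX : T.incl ⁻¹ᵁ V ≤ T.incl ⁻¹ᵁ W) h
    (a : Fn T.tot W),
    θ V (hX.trans h) (rs hVW a) = (rs hX (θ W h a).fst, rs hX (θ W h a).snd)
  E : ∀ W : T.tot.Opens, T.incl ⁻¹ᵁ W ≤ C.U i → Sec T.sheaf W
  E_res : ∀ (V W : T.tot.Opens) (hVW : V ≤ W) (hX : T.incl ⁻¹ᵁ V ≤ T.incl ⁻¹ᵁ W) h,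
    rm T.sheaf hVW (E W h) = E V (hX.trans h)
  E_lift : ∀ W h, (T.restr.app W (E W h) : Sec L (T.incl ⁻¹ᵁ W)) = C.eAt i _ h
  E_frame : ∀ W h, IsFrame T.sheaf (E W h)

/-- The function `a + ε b` on `W`, in a trivialisation over `U i`. -/
def LocalTriv.fn {T : FirstOrderDeformation P D} {C : FramedCover L ι} {i : ι}
    (τ : LocalTriv T C i) (W : T.tot.Opens) (h : T.incl ⁻¹ᵁ W ≤ C.U i)
    (a b : Fn X (T.incl ⁻¹ᵁ W)) : Fn T.tot W :=
  (τ.θ W h).symm (TrivSqZeroExt.inl a + TrivSqZeroExt.inr b)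

/-- The cocycle `({(W_i, -Λ_i)}, {(a_ij, p_ij)})` (the first pair read in the chart `i`, the second
one in the chart `j`) of a system of trivialisations:
* the Poisson structure is `Λ₀ + ε Λ_i` in the trivialisation over `U i`;
* the connection is given by `T_i + ε W_i` in the frame `E_i`;
* the change of trivialisation `θ_i θ_j⁻¹` is `id + ε p_ij`;
* the transition function is `f_ij + ε f_ij a_ij`, i.e. `E_j = (f_ij + ε f_ij a_ij) E_i`, as a
  function in the trivialisation over `U i`. -/
structure IsCocycleOf (τ : ∀ i, LocalTriv T C i) (c : CochE f C) : Prop where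
  poisson : ∀ i W (h : T.incl ⁻¹ᵁ W ≤ C.U i) (a b : Fn X (T.incl ⁻¹ᵁ W)),
    T.poisson.br W ((τ i).fn W h a 0) ((τ i).fn W h b 0) =
      (τ i).fn W h (P.br _ a b) (-((c.1 i).1 i ⟨_, h, h⟩).2 a b)
  conn : ∀ i W (h : T.incl ⁻¹ᵁ W ≤ C.U i) (a : Fn X (T.incl ⁻¹ᵁ W)),
    T.conn.br W ((τ i).fn W h a 0) ((τ i).E W h) =
      (τ i).fn W h (vecT D C i _ h a) (((c.1 i).1 i ⟨_, h, h⟩).1 a) • (τ i).E W h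
  change : ∀ i j W (hi : T.incl ⁻¹ᵁ W ≤ C.U i) (hj : T.incl ⁻¹ᵁ W ≤ C.U j)
    (a : Fn X (T.incl ⁻¹ᵁ W)),
    (τ j).fn W hj a 0 = (τ i).fn W hi a (((c.2 i j).1 j ⟨_, le_inf hi hj, hj⟩).2 a)
  trans : ∀ i j W (hi : T.incl ⁻¹ᵁ W ≤ C.U i) (hj : T.incl ⁻¹ᵁ W ≤ C.U j),
    (τ j).E W hj =
      (τ i).fn W hi (C.trans i j _ hi hj)
        (C.trans i j _ hi hj * ((c.2 i j).1 j ⟨_, le_inf hi hj, hj⟩).1) • (τ i).E W hi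

/-- The deformation is defined by the class `η ∈ ℍ¹(X, Λ₀, 𝓔_L^•)`. -/
def IsDefinedBy (η : H1E D C) : Prop :=
  ∃ (τ : ∀ i, LocalTriv T C i) (c : Z1E D C), T.IsCocycleOf C τ c.1 ∧ QuotientAddGroup.mk c = η

end FirstOrderDeformation

end PoissonDeformation

end

open PoissonDeformation

open PoissonDeformation

namespace PoissonDeformation

/-! The obstruction to lifting `s` is computed chart by chart. Over `U i`, a section of the deformed
sheaf restricting to `s` has the form (s_i - ε z_i) E_i: its function part is forced to be the
coordinate s_i of `s`, because E_i lifts e_i, and its ε-part is an arbitrary section z_i of `L` over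
`U i`, read in the frame e_i. Extending `s` therefore amounts to choosing the z_i so that these
local lifts are horizontal and glue.

Both conditions are read off in coordinates. The bracket of a with (s_i - ε z_i) E_i has zero
constant part because `s` is horizontal. Its ε-part is s_i W_i(a) + Λ_i(a, s_i) minus the coordinate
of {a, z_i}, and since the cocycle carries -Λ_i, the first two terms form the coordinate of M_1(W_i,
-Λ_i)(s)(a). So the lift is horizontal exactly when M_1(W_i, -Λ_i)(s) = v₀(z_i)
(`br_liftSec_eq_zero_iff`). On overlaps, rewriting E_j and the functions of chart j in chart i shows
that the lifts agree exactly when M_0(a_ij, p_ij)(s) = z_j - z_i (`liftSec_eq_iff`).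

Together these equations say that (z_i) is a 0-cochain whose total differential is the cochain
`MCoch C c s`; the minus sign in front of z_i is what makes the signs match. Hence `s` extends if
and only if that cochain is a coboundary (`extends_iff`), which is the vanishing of its class. Two
geometric inputs pass between `X` and the total space: the closed fibre has the same open sets
(`exists_preimage_eq`, `le_of_preimage_le`), and sections of modules satisfy the sheaf axioms. -/

/-! ### The sheaf axioms for sections of a module. -/

theorem rm_self {X : Scheme.{u}} (M : X.Modules) {V : X.Opens} (h : V ≤ V) (s : Sec M V) :
    rm M h s = s := by
  change M.presheaf.map (𝟙 _) s = s
  rw [M.presheaf.map_id]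
  rfl

/-- Sections of a module that agree locally are equal. -/
theorem sec_eq_of_locally_eq {X : Scheme.{u}} (M : X.Modules) {κ : Type v} (W : κ → X.Opens)
    {V : X.Opens} (hW : ∀ i, W i ≤ V) (hcover : V ≤ ⨆ i, W i) {s t : Sec M V}
    (h : ∀ i, rm M (hW i) s = rm M (hW i) t) : s = t :=
  TopCat.Sheaf.eq_of_locally_eq' ⟨M.presheaf, M.isSheaf⟩ W V (fun i => homOfLE (hW i)) hcover s t h

/-- Compatible local sections of a module glue. -/
theorem exists_sec_gluing {X : Scheme.{u}} (M : X.Modules) {κ : Type v} (W : κ → X.Opens)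
    (hcover : ⊤ ≤ ⨆ i, W i) (t : ∀ i, Sec M (W i))
    (h : ∀ i j, rm M (inf_le_left : W i ⊓ W j ≤ W i) (t i) =
      rm M (inf_le_right : W i ⊓ W j ≤ W j) (t j)) :
    ∃ s : Sec M ⊤, ∀ i, rm M le_top s = t i :=
  (TopCat.Sheaf.existsUnique_gluing' ⟨M.presheaf, M.isSheaf⟩ W ⊤ (fun _ => homOfLE le_top)
    hcover t h).exists

/-! ### The closed fibre: open sets and restriction of sections. -/

/-- The kernel of k[ε] → k is nilpotent, so every prime of k[ε] contains it and comes from k. -/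
theorem closedPoint_surjective (k : Type u) [Field k] : Surjective (closedPoint k) := by
  refine ⟨fun x => ?_⟩
  have hs : Function.Surjective (TrivSqZeroExt.fstHom k k k).toRingHom :=
    TrivSqZeroExt.fst_surjective
  have h : x ∈ Set.range (PrimeSpectrum.comap (TrivSqZeroExt.fstHom k k k).toRingHom) := by
    rw [range_comap_of_surjective _ _ hs]
    refine (PrimeSpectrum.mem_zeroLocus _ _).mpr fun a (ha : a.fst = 0) => ?_
    -- An element with zero constant part is a multiple of ε, so its square vanishes.
    have h0 : a * a = 0 := by ext <;> simp [ha]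
    exact x.2.mem_of_pow_mem 2 (by rw [pow_two, h0]; exact x.1.zero_mem)
  exact h

instance (k : Type u) [Field k] : IsClosedImmersion (closedPoint k) :=
  IsClosedImmersion.spec_of_surjective _ TrivSqZeroExt.fst_surjective

namespace FirstOrderDeformation

variable {k : Type u} [Field k] {X : Scheme.{u}} {f : X ⟶ Spec (.of k)}
  {P : PoissonStructure f} {L : X.Modules} {D : FlatPoissonConnection P L}
  (T : FirstOrderDeformation P D) {ι : Type v} (C : FramedCover L ι)

/-- Surjectivity is stable under base change, and the closed fibre is the base change of
`closedPoint k`. -/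
theorem incl_surjective : Function.Surjective T.incl := by
  have := closedPoint_surjective k
  exact (MorphismProperty.of_isPullback (P := @Surjective) T.isPullback.flip this).surj

/-- The inclusion is a base change of a closed immersion, hence a topological embedding. This lets
any open of `X` be replaced by the trace of an open of the total space, where the trivialisations
are indexed. -/
theorem exists_preimage_eq (V : X.Opens) : ∃ W : T.tot.Opens, T.incl ⁻¹ᵁ W = V := by
  have : IsClosedImmersion T.incl :=
    MorphismProperty.of_isPullback (P := @IsClosedImmersion) T.isPullback.flip inferInstance
  obtain ⟨W, hW, h⟩ := T.incl.isEmbedding.isOpen_iff.mp V.2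
  exact ⟨⟨W, hW⟩, TopologicalSpace.Opens.ext h⟩

/-- Surjectivity of the inclusion makes taking traces reflect the order, so an open of the total
space is determined by its trace. -/
theorem le_of_preimage_le {V W : T.tot.Opens} (h : T.incl ⁻¹ᵁ V ≤ T.incl ⁻¹ᵁ W) : V ≤ W := by
  intro y hy
  obtain ⟨x, rfl⟩ := T.incl_surjective y
  exact h hy

/-- Restriction of sections of `ℒ` to the closed fibre. -/
noncomputable def restrHom (W : T.tot.Opens) : Sec T.sheaf W →+ Sec L (T.incl ⁻¹ᵁ W) :=
  (T.restr.app W).hom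

theorem restrHom_smul (W : T.tot.Opens) (a : Fn T.tot W) (s : Sec T.sheaf W) :
    T.restrHom W (a • s) = T.incl.app W a • T.restrHom W s :=
  Scheme.Modules.Hom.app_smul T.restr a s

theorem restrHom_rm {V W : T.tot.Opens} (h : V ≤ W) (h' : T.incl ⁻¹ᵁ V ≤ T.incl ⁻¹ᵁ W)
    (s : Sec T.sheaf W) : T.restrHom V (rm T.sheaf h s) = rm L h' (T.restrHom W s) :=
  congr($(T.restr.mapPresheaf.naturality (homOfLE h).op) s)

/-! ### Coordinates of functions and sections in one trivialisation. -/

namespace LocalTriv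

variable {T C} {i : ι} (τ : LocalTriv T C i) {W : T.tot.Opens} (h : T.incl ⁻¹ᵁ W ≤ C.U i)

theorem θ_fn (a b : Fn X (T.incl ⁻¹ᵁ W)) :
    τ.θ W h (τ.fn W h a b) = TrivSqZeroExt.inl a + TrivSqZeroExt.inr b :=
  (τ.θ W h).apply_symm_apply _

theorem fn_θ (x : Fn T.tot W) : τ.fn W h (τ.θ W h x).fst (τ.θ W h x).snd = x := by
  rw [fn, TrivSqZeroExt.inl_fst_add_inr_snd_eq, RingEquiv.symm_apply_apply]

theorem fn_inj {a b a' b' : Fn X (T.incl ⁻¹ᵁ W)} (e : τ.fn W h a b = τ.fn W h a' b') :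
    a = a' ∧ b = b' := by
  have e' := congrArg (τ.θ W h) e
  rw [θ_fn, θ_fn] at e'
  exact ⟨by simpa using congrArg TrivSqZeroExt.fst e', by simpa using congrArg TrivSqZeroExt.snd e'⟩

theorem fn_zero : τ.fn W h 0 0 = 0 := by simp [fn]

theorem fn_add (a b a' b' : Fn X (T.incl ⁻¹ᵁ W)) :
    τ.fn W h a b + τ.fn W h a' b' = τ.fn W h (a + a') (b + b') := by
  apply (τ.θ W h).injective
  rw [map_add, θ_fn, θ_fn, θ_fn]
  ext <;> simp

theorem fn_mul (a b a' b' : Fn X (T.incl ⁻¹ᵁ W)) :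
    τ.fn W h a b * τ.fn W h a' b' = τ.fn W h (a * a') (a * b' + a' * b) := by
  apply (τ.θ W h).injective
  rw [map_mul, θ_fn, θ_fn, θ_fn]
  ext <;> simp [mul_comm]

theorem cst_eps : cst T.str W DualNumber.eps = τ.fn W h 0 1 := by
  apply (τ.θ W h).injective
  rw [θ_fn, τ.θ_const W h]
  ext <;> simp

/-- `IsCocycleOf` describes brackets and changes of chart only on functions without ε-part. This
decomposition extends those formulas to all functions by k[ε]-linearity. -/
theorem fn_split (a b : Fn X (T.incl ⁻¹ᵁ W)) :
    τ.fn W h a b = τ.fn W h a 0 + cst T.str W DualNumber.eps * τ.fn W h b 0 := by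
  rw [τ.cst_eps h, fn_mul, fn_add]
  simp

theorem app_fn (a b : Fn X (T.incl ⁻¹ᵁ W)) : T.incl.app W (τ.fn W h a b) = a := by
  rw [← τ.θ_fst W h, θ_fn]
  simp

theorem rs_fn {V : T.tot.Opens} (hV : V ≤ W) (hX : T.incl ⁻¹ᵁ V ≤ T.incl ⁻¹ᵁ W)
    (a b : Fn X (T.incl ⁻¹ᵁ W)) :
    rs hV (τ.fn W h a b) = τ.fn V (hX.trans h) (rs hX a) (rs hX b) := by
  apply (τ.θ V (hX.trans h)).injective
  rw [τ.θ_res V W hV hX h, θ_fn, θ_fn]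
  ext <;> simp

/-- The section of `ℒ` with coordinate `a + ε b` in the frame `E`. -/
noncomputable def sec (a b : Fn X (T.incl ⁻¹ᵁ W)) : Sec T.sheaf W := τ.fn W h a b • τ.E W h

theorem exists_sec (t : Sec T.sheaf W) : ∃ a b, t = τ.sec h a b := by
  obtain ⟨x, hx⟩ := (τ.E_frame W h W le_rfl).2 t
  refine ⟨(τ.θ W h x).fst, (τ.θ W h x).snd, ?_⟩
  rw [sec, τ.fn_θ h x, ← hx]
  simp only [rm_self]

theorem smul_E_inj {x y : Fn T.tot W} (e : x • τ.E W h = y • τ.E W h) : x = y := by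
  apply (τ.E_frame W h W le_rfl).1
  simpa only [rm_self] using e

theorem sec_inj {a b a' b' : Fn X (T.incl ⁻¹ᵁ W)} (e : τ.sec h a b = τ.sec h a' b') :
    a = a' ∧ b = b' :=
  τ.fn_inj h (τ.smul_E_inj h e)

theorem rm_sec {V : T.tot.Opens} (hV : V ≤ W) (hX : T.incl ⁻¹ᵁ V ≤ T.incl ⁻¹ᵁ W)
    (a b : Fn X (T.incl ⁻¹ᵁ W)) :
    rm T.sheaf hV (τ.sec h a b) = τ.sec (hX.trans h) (rs hX a) (rs hX b) := by
  rw [sec, rm_smul, τ.rs_fn h hV hX, τ.E_res V W hV hX h, sec]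

theorem restrHom_sec (a b : Fn X (T.incl ⁻¹ᵁ W)) :
    T.restrHom W (τ.sec h a b) = a • C.eAt i _ h := by
  rw [sec, restrHom_smul, app_fn]
  exact congrArg _ (τ.E_lift W h)

/-- A lift of a section `s` of `L` has coordinate `coord s + ε b` for some function `b`. -/
theorem exists_sec_of_restrHom {t : Sec T.sheaf W} {s : Sec L (T.incl ⁻¹ᵁ W)}
    (e : T.restrHom W t = s) : ∃ b, t = τ.sec h (C.coord i _ h s) b := by
  obtain ⟨a, b, rfl⟩ := τ.exists_sec h t
  rw [restrHom_sec] at e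
  exact ⟨b, by rw [C.coord_eq i _ h e]⟩

/-- The lift of `s` to `W` whose `ε`-part is the restriction of `-z`. -/
noncomputable def liftSec (s : Sec L ⊤) (z : Sec L (C.U i)) (W : T.tot.Opens)
    (h : T.incl ⁻¹ᵁ W ≤ C.U i) : Sec T.sheaf W :=
  τ.sec h (C.coord i _ h (rm L le_top s)) (-C.coord i _ h (rm L h z))

theorem rm_liftSec (s : Sec L ⊤) (z : Sec L (C.U i)) {V : T.tot.Opens} (hV : V ≤ W)
    (hX : T.incl ⁻¹ᵁ V ≤ T.incl ⁻¹ᵁ W) :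
    rm T.sheaf hV (τ.liftSec s z W h) = τ.liftSec s z V (hX.trans h) := by
  rw [liftSec, τ.rm_sec h hV hX, map_neg, C.rs_coord, C.rs_coord, rm_rm, rm_rm, liftSec]

theorem restrHom_liftSec (s : Sec L ⊤) (z : Sec L (C.U i)) :
    T.restrHom W (τ.liftSec s z W h) = rm L le_top s := by
  rw [liftSec, restrHom_sec, C.coord_smul]

/-- Every global lift is locally of the standard form, with a single z over all of `U i`: the ε-part
is read once on the open of the total space with trace `U i`, and all smaller opens inherit it by
restriction. -/
theorem exists_liftSec (s : Sec L ⊤) {t : Sec T.sheaf ⊤} (ht : T.restrHom ⊤ t = s) :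
    ∃ z : Sec L (C.U i), ∀ W h, rm T.sheaf le_top t = τ.liftSec s z W h := by
  obtain ⟨W, hW⟩ := T.exists_preimage_eq (C.U i)
  have ht' : ∀ V : T.tot.Opens, T.restrHom V (rm T.sheaf le_top t) = rm L le_top s := by
    intro V
    rw [T.restrHom_rm le_top le_top, ht]
    rfl
  obtain ⟨b, hb⟩ := τ.exists_sec_of_restrHom hW.le (ht' W)
  -- The sign cancels the one in `liftSec`. The restriction along `hW.ge` only transports the
  -- section across the equality of the trace of `W` with `C.U i`.
  refine ⟨-rm L hW.ge (b • C.eAt i _ hW.le), fun V h => ?_⟩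
  have hV : V ≤ W := T.le_of_preimage_le (h.trans hW.ge)
  rw [← rm_rm T.sheaf hV le_top, hb, τ.rm_sec hW.le hV (h.trans hW.ge), C.rs_coord, rm_rm, liftSec,
    map_neg, rm_rm, rm_smul, C.rm_eAt]
  congr 1
  have e : C.coord i _ h (-(rs (h.trans hW.ge) b • C.eAt i _ h)) = -rs (h.trans hW.ge) b :=
    C.coord_eq i _ h (neg_smul _ _)
  rw [e, neg_neg]

end LocalTriv

/-! ### Horizontality and gluing of local lifts, expressed through the cocycle. -/

namespace IsCocycleOf

variable {T C} {τ : ∀ i, LocalTriv T C i} {c : CochE f C}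
  {W : T.tot.Opens}

/-- Change of trivialisation for sections of `ℒ`. -/
theorem sec_change (hc : T.IsCocycleOf C τ c) (i j : ι) (hi : T.incl ⁻¹ᵁ W ≤ C.U i)
    (hj : T.incl ⁻¹ᵁ W ≤ C.U j)
    (a b : Fn X (T.incl ⁻¹ᵁ W)) :
    (τ j).sec hj a b = (τ i).sec hi (C.trans i j _ hi hj * a)
      (C.trans i j _ hi hj * (a * ((c.2 i j).1 j ⟨_, le_inf hi hj, hj⟩).1 +
        ((c.2 i j).1 j ⟨_, le_inf hi hj, hj⟩).2 a + b)) := by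
  rw [LocalTriv.sec, LocalTriv.sec, hc.trans i j W hi hj, smul_smul]
  congr 1
  -- Both summands change chart separately. The correction p_ij(b) to the ε-part comes multiplied by
  -- ε² and drops out.
  rw [(τ j).fn_split, hc.change i j W hi hj, hc.change i j W hi hj, (τ i).cst_eps hi,
    LocalTriv.fn_mul, LocalTriv.fn_add, LocalTriv.fn_mul]
  congr 1 <;> ring

/-- The connection in a trivialisation. -/
theorem br_sec (hc : T.IsCocycleOf C τ c) (i : ι) (h : T.incl ⁻¹ᵁ W ≤ C.U i)
    (a σ g : Fn X (T.incl ⁻¹ᵁ W)) :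
    T.conn.br W ((τ i).fn W h a 0) ((τ i).sec h σ g) =
      (τ i).sec h (P.br _ a σ + σ * vecT D C i _ h a)
        (P.br _ a g + g * vecT D C i _ h a + σ * ((c.1 i).1 i ⟨_, h, h⟩).1 a -
          ((c.1 i).1 i ⟨_, h, h⟩).2 a σ) := by
  have e : T.poisson.br W ((τ i).fn W h a 0) ((τ i).fn W h σ g) =
      (τ i).fn W h (P.br _ a σ) (P.br _ a g - ((c.1 i).1 i ⟨_, h, h⟩).2 a σ) := by
    -- Linearity over ε is an axiom only in the first argument of the bracket; skew-symmetry moves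
    -- it to the second.
    have hconst : T.poisson.br W ((τ i).fn W h a 0)
        (cst T.str W DualNumber.eps * (τ i).fn W h g 0) =
        cst T.str W DualNumber.eps * T.poisson.br W ((τ i).fn W h a 0) ((τ i).fn W h g 0) := by
      rw [T.poisson.skew, T.poisson.const_left, T.poisson.skew W ((τ i).fn W h g 0)]
      ring
    rw [(τ i).fn_split h σ g, T.poisson.add_right, hconst, hc.poisson, hc.poisson,
      (τ i).cst_eps h, LocalTriv.fn_mul, LocalTriv.fn_add]
    congr 1 <;> ring
  rw [LocalTriv.sec, T.conn.leibniz_right, e, hc.conn, smul_smul, ← add_smul, LocalTriv.fn_mul,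
    LocalTriv.fn_add, LocalTriv.sec]
  congr 2
  ring

/-- A lift of a horizontal section is horizontal iff its `ε`-part cobounds `M_1`. -/
theorem br_liftSec_eq_zero_iff (hc : T.IsCocycleOf C τ c) (i : ι) (h : T.incl ⁻¹ᵁ W ≤ C.U i)
    (s : H0 D) (z : Sec L (C.U i)) :
    (∀ x, T.conn.br W x ((τ i).liftSec s.1 z W h) = 0) ↔
      ∀ a, M1At C i _ h ((c.1 i).1 i ⟨_, h, h⟩) (rm L le_top s.1) a = D.br _ a (rm L h z) := by
  -- It suffices to test functions without ε-part; the general case follows at the end by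
  -- k[ε]-linearity.
  have key : ∀ a, T.conn.br W ((τ i).fn W h a 0) ((τ i).liftSec s.1 z W h) = 0 ↔
      M1At C i _ h ((c.1 i).1 i ⟨_, h, h⟩) (rm L le_top s.1) a = D.br _ a (rm L h z) := by
    intro a
    have hs := flat_coord D C i _ h (H0_flat D s _) a
    have hneg : ∀ y, P.br (T.incl ⁻¹ᵁ W) a (-y) = -P.br (T.incl ⁻¹ᵁ W) a y := by
      intro y
      have h0 := P.add_right (T.incl ⁻¹ᵁ W) a 0 0
      have h1 := P.add_right (T.incl ⁻¹ᵁ W) a y (-y)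
      rw [add_zero] at h0
      rw [add_neg_cancel, left_eq_add.mp h0] at h1
      exact (neg_eq_of_add_eq_zero_right h1.symm).symm
    -- The constant part of the bracket cancels by horizontality of `s`, leaving one equation
    -- between ε-parts.
    rw [LocalTriv.liftSec, hc.br_sec, hs, neg_add_cancel, M1At]
    have hz := br_coord D C i _ h a (C.coord i _ h (rm L h z))
    rw [C.coord_smul] at hz
    -- Skew-symmetry puts the coordinate of `s` in the first slot of the bivector, as in [b_i, s_i].
    rw [hz, hneg, ((c.1 i).2.1 i _ h h).2.skew a]
    constructor
    · intro e
      have e' := ((τ i).sec_inj h (e.trans (by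
        rw [LocalTriv.sec, LocalTriv.fn_zero, zero_smul] :
          (0 : Sec T.sheaf W) = (τ i).sec h 0 0))).2
      congr 1
      linear_combination e'
    · intro e
      have e' := C.smul_inj i _ h e
      rw [LocalTriv.sec, ← zero_smul (Fn T.tot W) ((τ i).E W h), ← (τ i).fn_zero h]
      congr 2
      linear_combination e'
  refine ⟨fun H a => (key a).1 (H _), fun H x => ?_⟩
  rw [← (τ i).fn_θ h x, (τ i).fn_split, T.conn.add_left, T.conn.const_left, (key _).2 (H _),
    (key _).2 (H _), smul_zero, add_zero]

/-- Two local lifts of `s` agree iff the difference of their `ε`-parts is `M_0`. -/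
theorem liftSec_eq_iff (hc : T.IsCocycleOf C τ c) (i j : ι) (hi : T.incl ⁻¹ᵁ W ≤ C.U i)
    (hj : T.incl ⁻¹ᵁ W ≤ C.U j) (s : Sec L ⊤) (zi : Sec L (C.U i)) (zj : Sec L (C.U j)) :
    (τ i).liftSec s zi W hi = (τ j).liftSec s zj W hj ↔
      M0At C j _ hj ((c.2 i j).1 j ⟨_, le_inf hi hj, hj⟩) (rm L le_top s) =
        rm L hj zj - rm L hi zi := by
  -- In chart i both lifts have the constant part f_ij s_j = s_i, so only the ε-parts remain to be
  -- compared.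
  rw [LocalTriv.liftSec, LocalTriv.liftSec, hc.sec_change i j hi hj, ← C.coord_trans, M0At]
  -- The difference z_j - z_i is written in the frame e_i, in which the ε-parts are compared.
  have e : rm L hj zj - rm L hi zi =
      (C.trans i j _ hi hj * C.coord j _ hj (rm L hj zj) - C.coord i _ hi (rm L hi zi)) •
        C.eAt i _ hi := by
    rw [← C.coord_trans, sub_smul, C.coord_smul, C.coord_smul]
  rw [e, ← C.trans_smul i j _ hi hj, smul_smul]
  constructor
  · intro H
    have H' := ((τ i).sec_inj hi H).2
    congr 1
    linear_combination -H'
  · intro H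
    have H' := C.smul_inj i _ hi H
    congr 1
    linear_combination -H'

/-! ### Global extension as a coboundary condition. -/

/-- `s` extends iff `M` sends the cocycle and `s` to a coboundary. -/
theorem extends_iff (hc : T.IsCocycleOf C τ c) (s : H0 D) :
    T.Extends s ↔ MCoch C c s.1 ∈ B1L D C := by
  constructor
  · rintro ⟨t, ht⟩
    choose z hz using fun i => (τ i).exists_liftSec s.1 (t := t.1) ht
    refine ⟨z, fun i => Subtype.ext ?_, fun i j => ?_⟩
    · funext ⟨V, hV⟩ a
      obtain ⟨W, rfl⟩ := T.exists_preimage_eq V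
      refine (hc.br_liftSec_eq_zero_iff i hV s (z i)).1 (fun x => ?_) a
      rw [← hz i]
      exact t.2 W x
    -- The overlap is generalised to a variable open so that it can be replaced by the trace of an
    -- open of the total space.
    · have H : ∀ V (hi : V ≤ C.U i) (hj : V ≤ C.U j),
          rm L (le_inf hi hj) ((MCoch C c s.1).2 i j) = rm L hj (z j) - rm L hi (z i) := by
        intro V hi hj
        obtain ⟨W, rfl⟩ := T.exists_preimage_eq V
        rw [MCoch_snd C c s.1 i j j _ hi hj hj]
        exact (hc.liftSec_eq_iff i j hi hj s.1 (z i) (z j)).1 ((hz i W hi).symm.trans (hz j W hj))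
      rw [← H _ inf_le_left inf_le_right, rm_self]
  · rintro ⟨z, hz, hz'⟩
    choose W hW using fun i => T.exists_preimage_eq (C.U i)
    have hcover : ⨆ i, W i = ⊤ := by
      refine top_le_iff.mp fun y _ => ?_
      obtain ⟨x, rfl⟩ := T.incl_surjective y
      have hx : x ∈ ⨆ i, C.U i := by rw [C.cover]; trivial
      obtain ⟨i, hi⟩ := TopologicalSpace.Opens.mem_iSup.mp hx
      refine TopologicalSpace.Opens.mem_iSup.mpr ⟨i, ?_⟩
      rw [← hW i] at hi
      exact hi
    obtain ⟨t, ht⟩ := exists_sec_gluing T.sheaf W hcover.ge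
      (fun i => (τ i).liftSec s.1 (z i) (W i) (hW i).le) (fun i j => by
        have hi : T.incl ⁻¹ᵁ (W i ⊓ W j) ≤ T.incl ⁻¹ᵁ W i := fun _ hx => hx.1
        have hj : T.incl ⁻¹ᵁ (W i ⊓ W j) ≤ T.incl ⁻¹ᵁ W j := fun _ hx => hx.2
        rw [LocalTriv.rm_liftSec _ _ _ _ _ hi, LocalTriv.rm_liftSec _ _ _ _ _ hj]
        -- Agreement on the overlap is the Čech component of the coboundary equation, restricted to
        -- the trace of `W i ⊓ W j`.
        refine (hc.liftSec_eq_iff i j _ _ s.1 (z i) (z j)).2 ?_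
        rw [← MCoch_snd C c s.1 i j j _ (hi.trans (hW i).le) (hj.trans (hW j).le)
          (hj.trans (hW j).le), hz', map_sub, rm_rm, rm_rm])
    refine ⟨⟨t, fun V a => ?_⟩, ?_⟩
    -- Horizontality is local: on each `V ⊓ W i` the glued section is the standard lift, and the
    -- component of the coboundary equation in L^1 applies.
    · refine sec_eq_of_locally_eq T.sheaf (fun i => V ⊓ W i) (fun _ => inf_le_left)
        (by rw [← inf_iSup_eq, hcover, inf_top_eq]) fun i => ?_
      have hi : T.incl ⁻¹ᵁ (V ⊓ W i) ≤ T.incl ⁻¹ᵁ W i := fun _ hx => hx.2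
      rw [T.conn.res _ _ inf_le_left, rm_rm, map_zero,
        ← rm_rm T.sheaf (inf_le_right : V ⊓ W i ≤ W i) le_top, ht,
        LocalTriv.rm_liftSec _ _ _ _ _ hi]
      refine (hc.br_liftSec_eq_zero_iff i (hi.trans (hW i).le) s (z i)).2 (fun b => ?_) _
      exact congrArg (fun w : L1 f L (C.U i) => w.1 ⟨_, hi.trans (hW i).le⟩ b) (hz i)
    · change T.restrHom ⊤ t = s.1
      refine sec_eq_of_locally_eq L (fun i => T.incl ⁻¹ᵁ W i) (fun _ => le_top)
        (by simp only [hW, C.cover]; exact le_rfl) fun i => ?_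
      exact (T.restrHom_rm le_top le_top t).symm.trans
        ((congrArg _ (ht i)).trans (LocalTriv.restrHom_liftSec _ _ _ _))

end IsCocycleOf

end FirstOrderDeformation
end PoissonDeformation

theorem mainTheorem11 {k : Type u} [Field k] [IsAlgClosed k] [CharZero k]
    {X : Scheme.{u}} (f : X ⟶ Spec (.of k)) [IsIntegral X] [Smooth f]
    (hX : IsProjectiveOver k f) (P : PoissonStructure f)
    (L : X.Modules) (hL : IsInvertibleSheaf L) (D : FlatPoissonConnection P L)
    {ι : Type v} (C : FramedCover L ι)
    (T : FirstOrderDeformation P D) (η : H1E D C) (hη : T.IsDefinedBy C η) (s : H0 D) :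
    T.Extends s ↔ M1 D C η s = 0 := by
  obtain ⟨τ, c, hc, rfl⟩ := hη
  rw [hc.extends_iff s]
  -- By construction `M1` sends the class of `c` and `s` to the class of `MCoch C c.1 s.1`, which
  -- vanishes exactly when this cochain lies in `B1L D C`.
  exact (QuotientAddGroup.eq_zero_iff (N := (B1L D C).addSubgroupOf (Z1L D C))
    (⟨MCoch C c.1 s.1, MCoch_mem D C c s⟩ : Z1L D C)).symm
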